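/- **Lichnerowicz formula on Lie manifolds.** Let $M$ be a compact (Hausdorff) $n$-dimensional manifold with corners with interior $M_0$, and let $(M,\mathcal A,\mathcal V)$ be a Lie manifold: $\mathcal V\subset\Gamma(TM)$ is a Lie algebra of smooth vector fields which are tangent to all boundary faces, it is a $C^\infty(M)$-submodule of $\Gamma(TM)$, and $\mathcal A\to M$ is a smooth real vector bundle with a bundle map (anchor) $\mathcal A\to TM$ that induces an isomorphism $\Gamma(\mathcal A)\cong\mathcal V$ and is an isomorphism $\mathcal A|_{M_0}\cong TM_0$ over the interior. Let $g$ be a smooth Riemannian metric on $\mathcal A$, let $\nabla$ be its Levi-Civita connection (the unique metric, torsion-free $\mathcal A^*$-valued connection on $\mathcal A$, where $\Gamma(\mathcal A)\cong\mathcal V$ carries the Lie bracket and acts on functions through the anchor), and let $R(X,Y)=[\nabla_X,\nabla_Y]-\nabla_{[X,Y]}$ be its curvature. Let $W\to M$ be a $\mathrm{Cl}(\mathcal A)$-module: a smooth complex vector bundle with a smooth hermitian metric $\langle\cdot,\cdot\rangle$, a smooth Clifford multiplication $c:\mathcal A\otimes W\to W$, $X\otimes\varphi\mapsto X\cdot\varphi$,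 with $$X\cdot Y\cdot\varphi+Y\cdot X\cdot\varphi+2g(X,Y)\varphi=0,\qquad \langle X\cdot\psi,\varphi\rangle=-\langle\psi,X\cdot\varphi\rangle,$$ an $\mathcal A^*$-valued complex-linear connection $\nabla^W$ on $W$ that is metric, $\partial_X\langle\psi,\varphi\rangle=\langle\nabla^W_X\psi,\varphi\rangle+\langle\psi,\nabla^W_X\varphi\rangle$, and admissible, $\nabla^W_X(Y\cdot\varphi)=(\nabla_XY)\cdot\varphi+Y\cdot\nabla^W_X\varphi$, and a smooth $\mathbb Z_2$-grading $W=W^+\oplus W^-$ which Clifford multiplication by vectors interchanges. Let $e_1,\dots,e_n$ denote a local orthonormal frame of $\mathcal A$, and put * $D\psi=\sum_i e_i\cdot\nabla^W_{e_i}\psi$, i.e. $D=c\circ(\mathrm{id}\otimes\sharp)\circ\nabla^W:\Gamma(W)\to\Gamma(W)$ (the geometric Dirac operator); * $\Delta^W=-\sum_{i,j}g^{ij}\bigl(\nabla^W_i\nabla^W_j-\sum_k\Gamma_{ij}^k\nabla^W_k\bigr)$, minus the $g$-trace of $(X,Y)\mapsto\nabla^W_X\nabla^W_Y-\nabla^W_{\nabla_XY}$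 (the connection Laplacian); * $R^W(X,Y)=\frac14\sum_{k,l}g(R(X,Y)e_k,e_l)\,c(e_k)c(e_l)$ and $F^{W/S}=(\nabla^W)^2-R^W$ (the twisting curvature), where $(\nabla^W)^2(X,Y)=[\nabla^W_X,\nabla^W_Y]-\nabla^W_{[X,Y]}$; * $c(F^{W/S})=\sum_{i<j}F^{W/S}(e_i,e_j)c(e_i)c(e_j)$; * $\kappa=\sum_{i,k}g(R(e_i,e_k)e_k,e_i)$ (the scalar curvature). Then $F^{W/S}$ is a smooth section of $\Lambda^2\mathcal A^*\otimes\mathrm{End}_{\mathrm{Cl}(\mathcal A)}(W)$, i.e. a smooth alternating two-form on $\mathcal A$ with values in the complex-linear endomorphisms of $W$ commuting with Clifford multiplication, and, on $\Gamma(W)$, $$D^2=\Delta^W+c(F^{W/S})+\frac{\kappa}{4}.$$ -/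

import Mathlib

open scoped Manifold ContDiff Bundle Topology InnerProductSpace
open Bundle Module

noncomputable section

namespace LieMfd

set_option linter.unusedSectionVars false

section Bundles

variable {E : Type*} [NormedAddCommGroup E] [NormedSpace ℝ E] {H : Type*} [TopologicalSpace H]
  {I : ModelWithCorners ℝ E H} {M : Type*} [TopologicalSpace M] [ChartedSpace H M]
  {F : Type*} [NormedAddCommGroup F] [NormedSpace ℝ F]
  {V : M → Type*} [TopologicalSpace (TotalSpace F V)] [∀ x, AddCommGroup (V x)]
  [∀ x, Module ℝ (V x)] [∀ x, TopologicalSpace (V x)] [FiberBundle F V] [VectorBundle ℝ F V]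

/-- A smooth real function, bundled. -/
def mkFun (f : M → ℝ) (hf : ContMDiff I 𝓘(ℝ, ℝ) ∞ f) : C^∞⟮I, M; ℝ⟯ := ⟨f, hf⟩

@[simp] theorem mkFun_apply (f : M → ℝ) (hf : ContMDiff I 𝓘(ℝ, ℝ) ∞ f) (x : M) :
    mkFun f hf x = f x := rfl

/-- The product `f • s` of a smooth function and a smooth section. -/
def funSMul (f : C^∞⟮I, M; ℝ⟯) (s : Cₛ^∞⟮I; F, V⟯) : Cₛ^∞⟮I; F, V⟯ :=
  ⟨fun x => f x • s x, f.contMDiff.smul_section s.contMDiff⟩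

@[simp] theorem funSMul_apply (f : C^∞⟮I, M; ℝ⟯) (s : Cₛ^∞⟮I; F, V⟯) (x : M) :
    funSMul f s x = f x • s x := rfl

variable [FiniteDimensional ℝ E] [IsManifold I ∞ M] [T2Space M] [FiniteDimensional ℝ F]
  [ContMDiffVectorBundle ∞ F V I]

variable (I F V) in
/-- Around every point there are global smooth sections `e i` and fibrewise linear functionals
`θ i`, smooth on smooth sections, which near the point are a frame and its dual coframe. -/
theorem exists_frame (x₀ : M) :
    ∃ (e : Fin (finrank ℝ F) → Cₛ^∞⟮I; F, V⟯) (θ : Fin (finrank ℝ F) → ∀ x, V x →ₗ[ℝ] ℝ),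
      (∀ i (s : ∀ x, V x) (x : M), ContMDiffAt I (I.prod 𝓘(ℝ, F)) ∞ (fun x => TotalSpace.mk' F x (s x)) x →
        ContMDiffAt I 𝓘(ℝ, ℝ) ∞ (fun x => θ i x (s x)) x) ∧
      ∀ᶠ y in 𝓝 x₀, (∀ v : V y, v = ∑ i, θ i y v • e i y) ∧
        (∀ i j, θ i y (e j y) = if i = j then 1 else 0) := by
  classical
  set t := trivializationAt F V x₀ with ht
  have : ContMDiffVectorBundle 1 F V I := ContMDiffVectorBundle.of_le (n := ∞) (by norm_cast)
  let b := finBasis ℝ F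
  have hx₀ : t.baseSet ∈ 𝓝 x₀ :=
    t.open_baseSet.mem_nhds (FiberBundle.mem_baseSet_trivializationAt F V x₀)
  obtain ⟨χ, -, hχ⟩ := (SmoothBumpFunction.nhds_basis_tsupport (I := I) x₀).mem_iff.1 hx₀
  refine ⟨fun i => ⟨fun x => χ x • t.localFrame b i x, ?_⟩,
    fun i x => χ x • t.localFrameCoeff I b i x, ?_, ?_⟩
  · exact ContMDiffOn.smul_section_of_tsupport (u := t.baseSet) χ.contMDiff.contMDiffOn
      t.open_baseSet hχ (t.contMDiffOn_localFrame_baseSet ∞ b i)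
  · intro i s x hs
    by_cases hx : x ∈ tsupport χ
    · have h2 := (contMDiffAt_iff_localFrameCoeff (I := I) (k := ∞) (e := t) b (hχ hx)).1 hs i
      exact χ.contMDiffAt.mul h2
    · have : (fun x => (χ x • t.localFrameCoeff I b i x) (s x)) =ᶠ[𝓝 x] fun _ => 0 := by
        have h1 : (tsupport χ)ᶜ ∈ 𝓝 x := (isClosed_tsupport χ).isOpen_compl.mem_nhds hx
        filter_upwards [h1] with y hy
        simp [image_eq_zero_of_notMem_tsupport hy]
      exact contMDiffAt_const.congr_of_eventuallyEq this
  · filter_upwards [χ.eventuallyEq_one, hx₀] with y hy hyt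
    have hy : χ y = 1 := hy
    refine ⟨fun v => ?_, fun i j => ?_⟩
    · have := t.eq_sum_localFrameCoeff_smul (I := I) (b := b) (s := fun z => if h : z = y then h ▸ v else 0) hyt
      simpa [hy] using this
    · have := t.localFrameCoeff_apply_of_mem_baseSet (I := I) b hyt (t.localFrame b j) i
      simp only [hy, one_smul, ContMDiffSection.coeFn_mk]
      rw [this, t.localFrame_apply_of_mem_baseSet b hyt, Basis.repr_self, Finsupp.single_apply]
      simp [eq_comm]

variable (I F) in
theorem exists_section {x₀ : M} (v : V x₀) : ∃ s : Cₛ^∞⟮I; F, V⟯, s x₀ = v := by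
  obtain ⟨e, θ, -, h⟩ := exists_frame I F V x₀
  refine ⟨∑ i, θ i x₀ v • e i, ?_⟩
  conv_rhs => rw [h.self_of_nhds.1 v]
  have : ∀ t : Finset (Fin (finrank ℝ F)), (∑ i ∈ t, θ i x₀ v • e i) x₀ = ∑ i ∈ t, θ i x₀ v • e i x₀ := by
    intro t
    classical
    induction t using Finset.induction_on with
    | empty => simp
    | insert a t ha ih => rw [Finset.sum_insert ha, Finset.sum_insert ha, ← ih]; rfl
  exact this _

/-- A smooth section through a prescribed vector. -/
def extend {x₀ : M} (v : V x₀) : Cₛ^∞⟮I; F, V⟯ := (exists_section I F v).choose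

theorem extend_apply {x₀ : M} (v : V x₀) : (extend v : Cₛ^∞⟮I; F, V⟯) x₀ = v :=
  (exists_section I F v).choose_spec

/-- An additive map on sections that is `C^∞(M)`-linear at `x₀` depends only on the value
of the section at `x₀`. -/
theorem tensorial_congr {Y : Type*} [AddCommGroup Y] [Module ℝ Y] {x₀ : M}
    (Φ : Cₛ^∞⟮I; F, V⟯ → Y) (hadd : ∀ s t, Φ (s + t) = Φ s + Φ t)
    (hsmul : ∀ f s, Φ (funSMul f s) = f x₀ • Φ s) {s t : Cₛ^∞⟮I; F, V⟯} (hst : s x₀ = t x₀) :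
    Φ s = Φ t := by
  obtain ⟨e, θ, hθ, h⟩ := exists_frame I F V x₀
  obtain ⟨χ, -, hχ⟩ := (SmoothBumpFunction.nhds_basis_support (I := I) h).mem_iff.1 h
  let χ' : C^∞⟮I, M; ℝ⟯ := mkFun χ χ.contMDiff
  let Φ' : Cₛ^∞⟮I; F, V⟯ →+ Y := AddMonoidHom.mk' Φ hadd
  have key : ∀ r : Cₛ^∞⟮I; F, V⟯, Φ r = ∑ i, θ i x₀ (r x₀) • Φ (funSMul χ' (e i)) := by
    intro r
    have h1 : funSMul χ' r = ∑ i, funSMul (mkFun (fun x => θ i x (r x)) fun x => hθ i r x (r.contMDiff x))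
        (funSMul χ' (e i)) := by
      ext x
      have hs : ∀ (g : Fin (finrank ℝ F) → Cₛ^∞⟮I; F, V⟯), (∑ i, g i) x = ∑ i, g i x := by
        intro g
        have := congrFun (map_sum (ContMDiffSection.coeAddHom I F ∞ V) g Finset.univ) x
        rw [Finset.sum_apply] at this
        exact this
      rw [hs]
      simp only [funSMul_apply]
      by_cases hx : x ∈ Function.support χ
      · conv_lhs => rw [(hχ hx).1 (r x)]
        rw [Finset.smul_sum]
        exact Finset.sum_congr rfl fun i _ => smul_comm _ _ _
      · have : χ' x = 0 := by simpa using! hx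
        rw [this, zero_smul]
        refine (Finset.sum_eq_zero fun i _ => ?_).symm
        rw [zero_smul, smul_zero]
    have h2 : Φ (funSMul χ' r) = Φ r := by
      have : χ' x₀ = 1 := χ.eq_one
      rw [hsmul, this, one_smul]
    rw [← h2, h1]
    change Φ' _ = _
    rw [map_sum]
    exact Finset.sum_congr rfl fun i _ => hsmul _ _
  rw [key s, key t, hst]

/-- The linear map on the fibre induced by a `C^∞(M)`-linear map on sections. -/
def tensorLift {Y : Type*} [AddCommGroup Y] [Module ℝ Y] {x₀ : M}
    (Φ : Cₛ^∞⟮I; F, V⟯ → Y) (hadd : ∀ s t, Φ (s + t) = Φ s + Φ t)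
    (hsmul : ∀ f s, Φ (funSMul f s) = f x₀ • Φ s) : V x₀ →ₗ[ℝ] Y where
  toFun v := Φ (extend v)
  map_add' u v := by
    rw [← hadd]
    exact tensorial_congr Φ hadd hsmul (by simp [extend_apply])
  map_smul' c v := by
    have := hsmul (mkFun (fun _ => c) contMDiff_const) (extend v)
    rw [RingHom.id_apply]
    refine Eq.trans ?_ this
    refine tensorial_congr Φ hadd hsmul ?_
    rw [extend_apply, funSMul_apply, extend_apply]
    rfl

theorem tensorLift_apply {Y : Type*} [AddCommGroup Y] [Module ℝ Y] {x₀ : M}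
    (Φ : Cₛ^∞⟮I; F, V⟯ → Y) (hadd : ∀ s t, Φ (s + t) = Φ s + Φ t)
    (hsmul : ∀ f s, Φ (funSMul f s) = f x₀ • Φ s) (s : Cₛ^∞⟮I; F, V⟯) :
    tensorLift Φ hadd hsmul (s x₀) = Φ s :=
  tensorial_congr Φ hadd hsmul (extend_apply _)

end Bundles

section Metric

variable {E : Type*} [NormedAddCommGroup E] [NormedSpace ℝ E] {H : Type*} [TopologicalSpace H]
  {I : ModelWithCorners ℝ E H} {M : Type*} [TopologicalSpace M] [ChartedSpace H M]
  {F : Type*} [NormedAddCommGroup F] [NormedSpace ℝ F] [FiniteDimensional ℝ F]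
  {A : M → Type*} [TopologicalSpace (TotalSpace F A)] [∀ x, NormedAddCommGroup (A x)]
  [∀ x, InnerProductSpace ℝ (A x)] [FiberBundle F A] [VectorBundle ℝ F A]

variable (F A) in
/-- An orthonormal basis of the fibre of a Riemannian vector bundle. -/
def fiberBasis (x : M) : OrthonormalBasis (Fin (finrank ℝ F)) ℝ (A x) :=
  have := VectorBundle.finiteDimensional ℝ F A x
  (stdOrthonormalBasis ℝ (A x)).reindex (finCongr (VectorBundle.finrank_eq ℝ F A x))

variable (F) in
/-- The trace of a bilinear form on the fibre with respect to the metric, that is its contraction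
with the inverse metric. -/
def metricTrace {Y : Type*} [AddCommGroup Y] [Module ℝ Y] {x : M}
    (B : A x →ₗ[ℝ] A x →ₗ[ℝ] Y) : Y :=
  ∑ i, B (fiberBasis F A x i) (fiberBasis F A x i)

theorem metricTrace_eq_of_dual {Y : Type*} [AddCommGroup Y] [Module ℝ Y] {x : M}
    (B : A x →ₗ[ℝ] A x →ₗ[ℝ] Y) {ι : Type*} [Fintype ι] (e d : ι → A x)
    (h : ∀ v : A x, v = ∑ i, ⟪d i, v⟫_ℝ • e i) :
    metricTrace F B = ∑ i, B (d i) (e i) := by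
  have h1 : ∀ i, B (d i) (e i) =
      ∑ j, B (fiberBasis F A x j) (⟪d i, fiberBasis F A x j⟫_ℝ • e i) := by
    intro i
    conv_lhs => rw [← (fiberBasis F A x).sum_repr' (d i)]
    simp [map_sum, real_inner_comm]
  rw [metricTrace, Finset.sum_congr rfl fun i _ => h1 i, Finset.sum_comm]
  refine Finset.sum_congr rfl fun j _ => ?_
  rw [← map_sum, ← h]

/-- The metric trace may be computed in any orthonormal basis. -/
theorem metricTrace_eq {Y : Type*} [AddCommGroup Y] [Module ℝ Y] {x : M}
    (B : A x →ₗ[ℝ] A x →ₗ[ℝ] Y) {ι : Type*} [Fintype ι] (b : OrthonormalBasis ι ℝ (A x)) :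
    metricTrace F B = ∑ i, B (b i) (b i) :=
  metricTrace_eq_of_dual B b b fun v => (b.sum_repr' v).symm

variable [FiniteDimensional ℝ E] [IsManifold I ∞ M] [T2Space M]
  [ContMDiffVectorBundle ∞ F A I] [IsContMDiffRiemannianBundle I ∞ F A]

/-- The function `x ↦ g(X x, Y x)`. -/
def metricFun (X Y : Cₛ^∞⟮I; F, A⟯) : C^∞⟮I, M; ℝ⟯ :=
  mkFun (fun x => ⟪X x, Y x⟫_ℝ) (X.contMDiff.inner_bundle Y.contMDiff)

@[simp] theorem metricFun_apply (X Y : Cₛ^∞⟮I; F, A⟯) (x : M) :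
    metricFun X Y x = ⟪X x, Y x⟫_ℝ := rfl

theorem contMDiffAt_of_inner (Y : ∀ x, A x) (x₀ : M)
    (h : ∀ Z : Cₛ^∞⟮I; F, A⟯, ContMDiffAt I 𝓘(ℝ, ℝ) ∞ (fun x => ⟪Y x, Z x⟫_ℝ) x₀) :
    ContMDiffAt I (I.prod 𝓘(ℝ, F)) ∞ (fun x => TotalSpace.mk' F x (Y x)) x₀ := by
  obtain ⟨e, θ, -, hθ⟩ := exists_frame I F A x₀
  let G : M → Matrix (Fin (finrank ℝ F)) (Fin (finrank ℝ F)) ℝ :=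
    fun y => Matrix.of fun i j => ⟪e i y, e j y⟫_ℝ
  have hdet : ∀ᶠ y in 𝓝 x₀, (G y).det ≠ 0 := by
    filter_upwards [hθ] with y hy hd
    obtain ⟨v, hv0, hv⟩ := Matrix.exists_vecMul_eq_zero_iff.2 hd
    apply hv0
    have hw : ∀ j, ⟪∑ i, v i • e i y, e j y⟫_ℝ = 0 := by
      intro j
      have := congrFun hv j
      simpa [G, Matrix.vecMul, dotProduct, sum_inner, inner_smul_left] using this
    have hw0 : ∑ i, v i • e i y = 0 := by
      have : ⟪∑ i, v i • e i y, ∑ i, v i • e i y⟫_ℝ = 0 := by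
        conv_lhs => rw [inner_sum]
        exact Finset.sum_eq_zero fun j _ => by rw [inner_smul_right, hw, mul_zero]
      exact inner_self_eq_zero.1 this
    ext j
    have := congrArg (θ j y) hw0
    simpa [map_sum, hy.2] using this
  have hexp : ∀ᶠ y in 𝓝 x₀, Y y =
      ∑ i, (∑ j, ⟪Y y, e j y⟫_ℝ * ((G y).det⁻¹ * (G y).adjugate j i)) • e i y := by
    filter_upwards [hθ, hdet] with y hy hd
    have hβ : Matrix.vecMul (fun i => θ i y (Y y)) (G y) = fun j => ⟪Y y, e j y⟫_ℝ := by
      ext j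
      conv_rhs => rw [hy.1 (Y y)]
      simp [G, Matrix.vecMul, dotProduct, sum_inner, inner_smul_left]
    have hinv : (fun i => θ i y (Y y)) =
        Matrix.vecMul (fun j => ⟪Y y, e j y⟫_ℝ) ((G y)⁻¹) := by
      rw [← hβ, Matrix.vecMul_vecMul, Matrix.mul_nonsing_inv _ (isUnit_iff_ne_zero.2 hd),
        Matrix.vecMul_one]
    conv_lhs => rw [hy.1 (Y y)]
    refine Finset.sum_congr rfl fun i _ => ?_
    rw [congrFun hinv i]
    simp [Matrix.vecMul, dotProduct, Matrix.inv_def]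
  have hG : ContMDiffAt I 𝓘(ℝ, Fin (finrank ℝ F) → Fin (finrank ℝ F) → ℝ) ∞
      (fun y => fun i j => ⟪e i y, e j y⟫_ℝ) x₀ := by
    rw [contMDiffAt_pi_space]
    intro i
    rw [contMDiffAt_pi_space]
    exact fun j => ((e i).contMDiff.inner_bundle (e j).contMDiff) x₀
  have hcd : ∀ i j, ContDiffAt ℝ ∞ (fun m : Fin (finrank ℝ F) → Fin (finrank ℝ F) → ℝ =>
      (Matrix.of m).det⁻¹ * (Matrix.of m).adjugate j i) (fun i j => ⟪e i x₀, e j x₀⟫_ℝ) := by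
    intro i j
    have h1 : ContDiff ℝ ∞ (fun m : Fin (finrank ℝ F) → Fin (finrank ℝ F) → ℝ =>
        (Matrix.of m).det) := by
      simp only [Matrix.det_apply, Matrix.of_apply]
      fun_prop
    have h2 : ContDiff ℝ ∞ (fun m : Fin (finrank ℝ F) → Fin (finrank ℝ F) → ℝ =>
        (Matrix.of m).adjugate j i) := by
      simp only [Matrix.adjugate_apply, Matrix.det_apply, Matrix.updateRow_apply,
        Matrix.of_apply]
      refine ContDiff.sum fun σ _ => ContDiff.const_smul _ (contDiff_prod fun k _ => ?_)
      split_ifs <;> fun_prop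
    exact (h1.contDiffAt.inv hdet.self_of_nhds).mul h2.contDiffAt
  have hsm : ContMDiffAt I (I.prod 𝓘(ℝ, F)) ∞ (fun y => TotalSpace.mk' F y
      (∑ i, (∑ j, ⟪Y y, e j y⟫_ℝ * ((G y).det⁻¹ * (G y).adjugate j i)) • e i y)) x₀ := by
    refine ContMDiffAt.sum_section fun i _ => ContMDiffAt.smul_section ?_ ((e i).contMDiff x₀)
    refine ContMDiffAt.sum fun j _ => (h (e j)).mul ?_
    exact (hcd i j).contMDiffAt.comp x₀ hG
  refine hsm.congr_of_eventuallyEq ?_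
  filter_upwards [hexp] with y hy
  rw [← hy]

variable {F' : Type*} [NormedAddCommGroup F'] [NormedSpace ℝ F']
  {V : M → Type*} [TopologicalSpace (TotalSpace F' V)] [∀ x, AddCommGroup (V x)]
  [∀ x, Module ℝ (V x)] [∀ x, TopologicalSpace (V x)] [FiberBundle F' V] [VectorBundle ℝ F' V]

/-- The metric trace of a smooth bilinear bundle map is smooth. -/
theorem contMDiff_metricTrace (B : ∀ x, A x →ₗ[ℝ] A x →ₗ[ℝ] V x)
    (hB : ∀ X Y : Cₛ^∞⟮I; F, A⟯,
      ContMDiff I (I.prod 𝓘(ℝ, F')) ∞ (fun x => TotalSpace.mk' F' x (B x (X x) (Y x)))) :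
    ContMDiff I (I.prod 𝓘(ℝ, F')) ∞ (fun x => TotalSpace.mk' F' x (metricTrace F (B x))) := by
  intro x₀
  obtain ⟨e, θ, hs, hθ⟩ := exists_frame I F A x₀
  have hd : ∀ i, ∃ d : Cₛ^∞⟮I; F, A⟯, ∀ y (v : A y), ⟪d y, v⟫_ℝ = θ i y v := by
    intro i
    have := fun y => VectorBundle.finiteDimensional ℝ F A y
    let D : ∀ y, A y := fun y =>
      (InnerProductSpace.toDual ℝ (A y)).symm (LinearMap.toContinuousLinearMap (θ i y))
    have hD : ∀ y (v : A y), ⟪D y, v⟫_ℝ = θ i y v := fun y v => by simp [D]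
    refine ⟨⟨D, fun y => contMDiffAt_of_inner D y fun Z => ?_⟩, hD⟩
    simp only [hD]
    exact hs i Z y (Z.contMDiff y)
  choose d hd using hd
  have : ContMDiffAt I (I.prod 𝓘(ℝ, F')) ∞ (fun x => TotalSpace.mk' F' x
      (∑ i, B x (d i x) (e i x))) x₀ :=
    ContMDiffAt.sum_section fun i _ => hB (d i) (e i) x₀
  refine this.congr_of_eventuallyEq ?_
  filter_upwards [hθ] with y hy
  rw [metricTrace_eq_of_dual (B y) (fun i => e i y) (fun i => d i y)]
  intro v
  simp only [hd]
  exact hy.1 v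

end Metric

section VectorFields

variable {E : Type*} [NormedAddCommGroup E] [NormedSpace ℝ E] {H : Type*} [TopologicalSpace H]
  {I : ModelWithCorners ℝ E H} {M : Type*} [TopologicalSpace M] [ChartedSpace H M]
  [IsManifold I ∞ M]

theorem contMDiff_mvfderiv_apply {Y : Type*} [NormedAddCommGroup Y] [NormedSpace ℝ Y] {f : M → Y}
    (hf : ContMDiff I 𝓘(ℝ, Y) ∞ f) {X : ∀ x : M, TangentSpace I x}
    (hX : ContMDiff I (I.prod 𝓘(ℝ, E)) ∞ (fun x => TotalSpace.mk' E x (X x))) :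
    ContMDiff I 𝓘(ℝ, Y) ∞ (fun x => mvfderiv I f x (X x)) := by
  have h1 := (ContMDiff.contMDiff_tangentMap (m := ∞) hf (by norm_cast)).comp hX
  exact (contMDiff_snd_tangentBundle_modelSpace Y 𝓘(ℝ, Y)).comp h1

theorem mvfderiv_chart {g : M → ℝ} (hg : ContMDiff I 𝓘(ℝ, ℝ) ∞ g) (X : ∀ x : M, TangentSpace I x)
    (x₀ : M) {z : E} (hz : z ∈ (extChartAt I x₀).target) :
    mvfderiv I g ((extChartAt I x₀).symm z) (X ((extChartAt I x₀).symm z)) =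
      fderivWithin ℝ (g ∘ (extChartAt I x₀).symm) (Set.range I) z
        (VectorField.mpullbackWithin 𝓘(ℝ, E) I (extChartAt I x₀).symm X (Set.range I) z) := by
  have : IsManifold I 1 M := IsManifold.of_le (n := ∞) (by norm_cast)
  have hinv := isInvertible_mfderivWithin_extChartAt_symm (I := I) hz
  have hU : UniqueMDiffWithinAt 𝓘(ℝ, E) (Set.range I) z :=
    I.uniqueMDiffOn z (extChartAt_target_subset_range x₀ hz)
  have hc : mfderivWithin 𝓘(ℝ, E) 𝓘(ℝ, ℝ) (g ∘ (extChartAt I x₀).symm) (Set.range I) z =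
      (mfderiv I 𝓘(ℝ, ℝ) g ((extChartAt I x₀).symm z)).comp
        (mfderivWithin 𝓘(ℝ, E) I (extChartAt I x₀).symm (Set.range I) z) :=
    mfderiv_comp_mfderivWithin z ((hg _).mdifferentiableAt (by simp))
      (mdifferentiableWithinAt_extChartAt_symm hz) hU
  rw [← mfderivWithin_eq_fderivWithin, hc]
  obtain ⟨e, he⟩ := hinv
  change _ = mfderiv I 𝓘(ℝ, ℝ) g ((extChartAt I x₀).symm z)
    (mfderivWithin 𝓘(ℝ, E) I (extChartAt I x₀).symm (Set.range I) z
      ((mfderivWithin 𝓘(ℝ, E) I (extChartAt I x₀).symm (Set.range I) z).inverse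
        (X ((extChartAt I x₀).symm z))))
  rw [← he, ContinuousLinearMap.inverse_equiv]
  change _ = mfderiv I 𝓘(ℝ, ℝ) g ((extChartAt I x₀).symm z) (e (e.symm _))
  rw [e.apply_symm_apply]
  rfl

theorem mvfderiv_mlieBracket [CompleteSpace E] {f : M → ℝ} (hf : ContMDiff I 𝓘(ℝ, ℝ) ∞ f)
    {X Y : ∀ x : M, TangentSpace I x}
    (hX : ContMDiff I (I.prod 𝓘(ℝ, E)) ∞ (fun x => TotalSpace.mk' E x (X x)))
    (hY : ContMDiff I (I.prod 𝓘(ℝ, E)) ∞ (fun x => TotalSpace.mk' E x (Y x)))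
    (x₀ : M) :
    mvfderiv I f x₀ (VectorField.mlieBracket I X Y x₀) =
      mvfderiv I (fun x => mvfderiv I f x (Y x)) x₀ (X x₀) -
        mvfderiv I (fun x => mvfderiv I f x (X x)) x₀ (Y x₀) := by
  have : IsManifold I 1 M := IsManifold.of_le (n := ∞) (by norm_cast)
  have : IsManifold I 2 M := IsManifold.of_le (n := ∞) (by norm_cast)
  have hz := mem_extChartAt_target (I := I) x₀
  have hr := extChartAt_target_subset_range (I := I) x₀ hz
  have key := fun (g : M → ℝ) hg Z => mvfderiv_chart (I := I) (g := g) hg Z x₀ hz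
  rw [extChartAt_to_inv] at key
  rw [key f hf, key _ (contMDiff_mvfderiv_apply hf hX), key _ (contMDiff_mvfderiv_apply hf hY)]
  set φ := extChartAt I x₀
  set X' := VectorField.mpullbackWithin 𝓘(ℝ, E) I φ.symm X (Set.range I)
  set Y' := VectorField.mpullbackWithin 𝓘(ℝ, E) I φ.symm Y (Set.range I)
  have h1 : ∀ Z : ∀ x : M, TangentSpace I x, fderivWithin ℝ ((fun x => mvfderiv I f x (Z x)) ∘ φ.symm) (Set.range I) (φ x₀) =
     fderivWithin ℝ (fun z => fderivWithin ℝ (f ∘ φ.symm) (Set.range I) z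
       (VectorField.mpullbackWithin 𝓘(ℝ, E) I φ.symm Z (Set.range I) z)) (Set.range I) (φ x₀) := by
    intro Z
    refine Filter.EventuallyEq.fderivWithin_eq_of_mem ?_ hr
    filter_upwards [extChartAt_target_mem_nhdsWithin (I := I) x₀] with z hz
    exact mvfderiv_chart hf Z x₀ hz
  rw [h1, h1]
  have h2 : VectorField.mpullbackWithin 𝓘(ℝ, E) I φ.symm (VectorField.mlieBracket I X Y) (Set.range I) (φ x₀)
      = VectorField.lieBracketWithin ℝ X' Y' (Set.range I) (φ x₀) := by
    have e1 : (fun y => (VectorField.mlieBracket I X Y y : E)) (φ.symm (φ x₀)) =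
        (fun y => (VectorField.mlieBracket I X Y y : E)) x₀ := by
      rw [show φ.symm (φ x₀) = x₀ from extChartAt_to_inv x₀]
    have e2 := mfderivWithin_extChartAt_symm_inverse_apply (I := I)
      (VectorField.mlieBracket I X Y x₀)
    refine (congrArg (mfderivWithin 𝓘(ℝ, E) I φ.symm (Set.range I) (φ x₀)).inverse e1).trans ?_
    refine e2.trans ?_
    rw [← VectorField.mlieBracketWithin_univ, VectorField.mlieBracketWithin_apply,
      mfderiv_extChartAt_self, Set.preimage_univ, Set.univ_inter]
    exact congrFun (congrArg DFunLike.coe ContinuousLinearMap.inverse_id) _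
  rw [h2]
  have hd : ∀ {Z : ∀ x : M, TangentSpace I x},
      ContMDiff I (I.prod 𝓘(ℝ, E)) ∞ (fun x => TotalSpace.mk' E x (Z x)) →
      DifferentiableWithinAt ℝ (VectorField.mpullbackWithin 𝓘(ℝ, E) I φ.symm Z (Set.range I))
        (Set.range I) (φ x₀) := by
    intro Z hZ
    have := MDifferentiableWithinAt.differentiableWithinAt_mpullbackWithin_vectorField (s := Set.univ)
      ((hZ x₀).mdifferentiableAt (by simp)).mdifferentiableWithinAt
    rwa [Set.preimage_univ, Set.univ_inter] at this
  refine VectorField.fderivWithin_apply_lieBracket (n := ∞) ?_ ?_ I.uniqueDiffOn ?_ hr (hd hY) (hd hX)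
  · exact (contMDiffAt_iff.1 (hf x₀)).2
  · rw [minSmoothness_of_isRCLikeNormedField]
    norm_cast
  · exact I.range_subset_closure_interior hr

end VectorFields

section LieStructures

variable {E : Type*} [NormedAddCommGroup E] [NormedSpace ℝ E] [FiniteDimensional ℝ E]
  {H : Type*} [TopologicalSpace H] {I : ModelWithCorners ℝ E H}
  {M : Type*} [TopologicalSpace M] [ChartedSpace H M] [IsManifold I ∞ M]
  {F : Type*} [NormedAddCommGroup F] [NormedSpace ℝ F]
  {A : M → Type*} [TopologicalSpace (TotalSpace F A)] [∀ x, NormedAddCommGroup (A x)]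
  [∀ x, InnerProductSpace ℝ (A x)] [FiberBundle F A] [VectorBundle ℝ F A]

variable (I F A) in
/-- A Lie algebra `𝓥` of vector fields that is a `C^∞(M)`-module, together with a vector bundle `A`
and a bundle map `A → TM` (the anchor) inducing an isomorphism `Γ(A) ≅ 𝓥`. In particular `𝓥` is a
finitely generated projective `C^∞(M)`-module when `M` is compact. -/
structure LieStructure where
  /-- The vector fields in `𝓥`. -/
  vectorFields : Submodule ℝ Cₛ^∞⟮I; E, (TangentSpace I : M → Type _)⟯
  funSMul_mem : ∀ (f : C^∞⟮I, M; ℝ⟯), ∀ X ∈ vectorFields, funSMul f X ∈ vectorFields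
  bracket_mem : ∀ X ∈ vectorFields, ∀ Y ∈ vectorFields, ∃ Z ∈ vectorFields,
    ∀ x, Z x = VectorField.mlieBracket I X Y x
  /-- The anchor `A → TM`. -/
  anchor : ∀ x, A x →ₗ[ℝ] TangentSpace I x
  anchor_smooth : ∀ X : Cₛ^∞⟮I; F, A⟯,
    ContMDiff I (I.prod 𝓘(ℝ, E)) ∞ (fun x => TotalSpace.mk' E x (anchor x (X x)))
  anchor_injective : ∀ X X' : Cₛ^∞⟮I; F, A⟯, (∀ x, anchor x (X x) = anchor x (X' x)) → X = X'
  mem_iff : ∀ Y, Y ∈ vectorFields ↔ ∃ X : Cₛ^∞⟮I; F, A⟯, ∀ x, Y x = anchor x (X x)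

namespace LieStructure

variable (L : LieStructure I F A)

theorem exists_bracket (X Y : Cₛ^∞⟮I; F, A⟯) : ∃ Z : Cₛ^∞⟮I; F, A⟯, ∀ x, L.anchor x (Z x) =
    VectorField.mlieBracket I (fun y => L.anchor y (X y)) (fun y => L.anchor y (Y y)) x := by
  obtain ⟨Z, hZ, h⟩ := L.bracket_mem ⟨_, L.anchor_smooth X⟩ ((L.mem_iff _).2 ⟨X, fun _ => rfl⟩)
    ⟨_, L.anchor_smooth Y⟩ ((L.mem_iff _).2 ⟨Y, fun _ => rfl⟩)
  obtain ⟨Z', hZ'⟩ := (L.mem_iff Z).1 hZ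
  exact ⟨Z', fun x => (hZ' x).symm.trans (h x)⟩

/-- The Lie bracket on `Γ(A) ≅ 𝓥`. -/
def bracket (X Y : Cₛ^∞⟮I; F, A⟯) : Cₛ^∞⟮I; F, A⟯ := (L.exists_bracket X Y).choose

theorem anchor_bracket (X Y : Cₛ^∞⟮I; F, A⟯) (x : M) : L.anchor x (L.bracket X Y x) =
    VectorField.mlieBracket I (fun y => L.anchor y (X y)) (fun y => L.anchor y (Y y)) x :=
  (L.exists_bracket X Y).choose_spec x

/-- The derivative of a function in the direction of `v ∈ A x`. -/
def deriv {Y : Type*} [NormedAddCommGroup Y] [NormedSpace ℝ Y] (f : M → Y) (x : M) :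
    A x →ₗ[ℝ] Y :=
  (mvfderiv I f x).toLinearMap ∘ₗ L.anchor x

theorem deriv_apply {Y : Type*} [NormedAddCommGroup Y] [NormedSpace ℝ Y] (f : M → Y) (x : M)
    (v : A x) : L.deriv f x v = mvfderiv I f x (L.anchor x v) := rfl

theorem contMDiff_deriv {f : M → ℝ} (hf : ContMDiff I 𝓘(ℝ, ℝ) ∞ f) (X : Cₛ^∞⟮I; F, A⟯) :
    ContMDiff I 𝓘(ℝ, ℝ) ∞ (fun x => L.deriv f x (X x)) :=
  contMDiff_mvfderiv_apply hf (L.anchor_smooth X)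

theorem deriv_add (f g : C^∞⟮I, M; ℝ⟯) (x : M) :
    L.deriv (fun y => f y + g y) x = L.deriv f x + L.deriv g x := by
  ext v
  simp only [deriv_apply, LinearMap.add_apply]
  rw [mvfderiv_fun_add ((f.contMDiff x).mdifferentiableAt (by simp))
    ((g.contMDiff x).mdifferentiableAt (by simp))]
  rfl

theorem deriv_mul (f g : C^∞⟮I, M; ℝ⟯) (x : M) :
    L.deriv (fun y => f y * g y) x = f x • L.deriv g x + g x • L.deriv f x := by
  ext v
  simp only [deriv_apply, LinearMap.add_apply, LinearMap.smul_apply]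
  rw [mvfderiv_fun_mul ((f.contMDiff x).mdifferentiableAt (by simp))
    ((g.contMDiff x).mdifferentiableAt (by simp))]
  rfl

theorem mdiff (X : Cₛ^∞⟮I; F, A⟯) (x : M) : MDifferentiableAt I (I.prod 𝓘(ℝ, E))
    (fun x => TotalSpace.mk' E x (L.anchor x (X x))) x :=
  ((L.anchor_smooth X) x).mdifferentiableAt (by simp)

theorem bracket_swap (X Y : Cₛ^∞⟮I; F, A⟯) : L.bracket X Y = -L.bracket Y X := by
  refine L.anchor_injective _ _ fun x => ?_
  rw [anchor_bracket, VectorField.mlieBracket_swap_apply, ← anchor_bracket, ← map_neg]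
  rfl

theorem bracket_add_right (X Y Z : Cₛ^∞⟮I; F, A⟯) :
    L.bracket X (Y + Z) = L.bracket X Y + L.bracket X Z := by
  refine L.anchor_injective _ _ fun x => ?_
  have := VectorField.mlieBracket_add_right (V := fun y => L.anchor y (X y))
    (L.mdiff Y x) (L.mdiff Z x)
  simp only [ContMDiffSection.coe_add, Pi.add_apply, map_add, anchor_bracket]
  exact this

theorem bracket_add_left (X Y Z : Cₛ^∞⟮I; F, A⟯) :
    L.bracket (X + Y) Z = L.bracket X Z + L.bracket Y Z := by
  rw [bracket_swap, bracket_add_right, L.bracket_swap X, L.bracket_swap Y]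
  abel

theorem bracket_funSMul_right (X Y : Cₛ^∞⟮I; F, A⟯) (f : C^∞⟮I, M; ℝ⟯) :
    L.bracket X (funSMul f Y) = funSMul f (L.bracket X Y) +
      funSMul (mkFun (fun x => L.deriv f x (X x)) (L.contMDiff_deriv f.contMDiff X)) Y := by
  refine L.anchor_injective _ _ fun x => ?_
  have := VectorField.mlieBracket_smul_right (V := fun y => L.anchor y (X y))
    ((f.contMDiff x).mdifferentiableAt (by simp)) (L.mdiff Y x)
  simp only [ContMDiffSection.coe_add, Pi.add_apply, map_add, anchor_bracket, funSMul_apply,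
    map_smul, mkFun_apply, deriv_apply]
  rw [add_comm]
  exact this

theorem bracket_funSMul_left (X Y : Cₛ^∞⟮I; F, A⟯) (f : C^∞⟮I, M; ℝ⟯) :
    L.bracket (funSMul f X) Y = funSMul f (L.bracket X Y) -
      funSMul (mkFun (fun x => L.deriv f x (Y x)) (L.contMDiff_deriv f.contMDiff Y)) X := by
  rw [bracket_swap, bracket_funSMul_right, L.bracket_swap X Y]
  ext x
  simp [sub_eq_add_neg, add_comm]

theorem deriv_bracket (f : C^∞⟮I, M; ℝ⟯) (X Y : Cₛ^∞⟮I; F, A⟯) (x : M) :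
    L.deriv f x (L.bracket X Y x) =
      L.deriv (fun y => L.deriv f y (Y y)) x (X x) -
        L.deriv (fun y => L.deriv f y (X y)) x (Y x) := by
  have := FiniteDimensional.complete ℝ E
  rw [deriv_apply, anchor_bracket]
  exact mvfderiv_mlieBracket f.contMDiff (L.anchor_smooth X) (L.anchor_smooth Y) x

end LieStructure

end LieStructures

section Connections

variable {E : Type*} [NormedAddCommGroup E] [NormedSpace ℝ E] [FiniteDimensional ℝ E]
  {H : Type*} [TopologicalSpace H] {I : ModelWithCorners ℝ E H}
  {M : Type*} [TopologicalSpace M] [ChartedSpace H M] [IsManifold I ∞ M]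
  {F : Type*} [NormedAddCommGroup F] [NormedSpace ℝ F]
  {A : M → Type*} [TopologicalSpace (TotalSpace F A)] [∀ x, NormedAddCommGroup (A x)]
  [∀ x, InnerProductSpace ℝ (A x)] [FiberBundle F A] [VectorBundle ℝ F A]
  {F' : Type*} [NormedAddCommGroup F'] [NormedSpace ℝ F']
  {V : M → Type*} [TopologicalSpace (TotalSpace F' V)] [∀ x, AddCommGroup (V x)]
  [∀ x, Module ℝ (V x)] [∀ x, TopologicalSpace (V x)] [FiberBundle F' V] [VectorBundle ℝ F' V]

/-- An `A*`-valued connection `∇ : Γ(V) → Γ(V ⊗ A*)` on a vector bundle `V`; here `toFun s x v`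
is `∇_v s` at `x`, for `v ∈ A x`. -/
structure Connection (L : LieStructure I F A) (F' : Type*) [NormedAddCommGroup F']
    [NormedSpace ℝ F'] (V : M → Type*) [TopologicalSpace (TotalSpace F' V)]
    [∀ x, AddCommGroup (V x)] [∀ x, Module ℝ (V x)] [∀ x, TopologicalSpace (V x)]
    [FiberBundle F' V] [VectorBundle ℝ F' V] where
  toFun : Cₛ^∞⟮I; F', V⟯ → ∀ x, A x →ₗ[ℝ] V x
  smooth : ∀ (s : Cₛ^∞⟮I; F', V⟯) (X : Cₛ^∞⟮I; F, A⟯),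
    ContMDiff I (I.prod 𝓘(ℝ, F')) ∞ (fun x => TotalSpace.mk' F' x (toFun s x (X x)))
  add : ∀ (s t : Cₛ^∞⟮I; F', V⟯) x v, toFun (s + t) x v = toFun s x v + toFun t x v
  leibniz : ∀ (f : C^∞⟮I, M; ℝ⟯) (s : Cₛ^∞⟮I; F', V⟯) x v,
    toFun (funSMul f s) x v = f x • toFun s x v + L.deriv f x v • s x

namespace Connection

variable {L : LieStructure I F A} (D : Connection L F' V)

/-- The covariant derivative `∇_X s`. -/
def cov (X : Cₛ^∞⟮I; F, A⟯) (s : Cₛ^∞⟮I; F', V⟯) : Cₛ^∞⟮I; F', V⟯ :=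
  ⟨fun x => D.toFun s x (X x), D.smooth s X⟩

@[simp] theorem cov_apply (X : Cₛ^∞⟮I; F, A⟯) (s : Cₛ^∞⟮I; F', V⟯) (x : M) :
    D.cov X s x = D.toFun s x (X x) := rfl

/-- The curvature `R(X, Y) s = ∇_X ∇_Y s - ∇_Y ∇_X s - ∇_[X,Y] s`. -/
def curvatureOp (X Y : Cₛ^∞⟮I; F, A⟯) (s : Cₛ^∞⟮I; F', V⟯) : Cₛ^∞⟮I; F', V⟯ :=
  D.cov X (D.cov Y s) - D.cov Y (D.cov X s) - D.cov (L.bracket X Y) s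

theorem curvatureOp_swap (X Y : Cₛ^∞⟮I; F, A⟯) (s : Cₛ^∞⟮I; F', V⟯) :
    D.curvatureOp X Y s = -D.curvatureOp Y X s := by
  ext x
  simp only [curvatureOp, L.bracket_swap X Y, ContMDiffSection.coe_sub, Pi.sub_apply,
    ContMDiffSection.coe_neg, Pi.neg_apply, cov_apply, map_neg]
  abel

theorem cov_add (X : Cₛ^∞⟮I; F, A⟯) (s t : Cₛ^∞⟮I; F', V⟯) :
    D.cov X (s + t) = D.cov X s + D.cov X t := by
  ext x
  exact D.add s t x _

theorem cov_add_left (X Y : Cₛ^∞⟮I; F, A⟯) (s : Cₛ^∞⟮I; F', V⟯) :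
    D.cov (X + Y) s = D.cov X s + D.cov Y s := by
  ext x
  simp

theorem cov_funSMul_left (f : C^∞⟮I, M; ℝ⟯) (X : Cₛ^∞⟮I; F, A⟯) (s : Cₛ^∞⟮I; F', V⟯) :
    D.cov (funSMul f X) s = funSMul f (D.cov X s) := by
  ext x
  simp

theorem cov_funSMul (f : C^∞⟮I, M; ℝ⟯) (X : Cₛ^∞⟮I; F, A⟯) (s : Cₛ^∞⟮I; F', V⟯) :
    D.cov X (funSMul f s) = funSMul f (D.cov X s) +
      funSMul (mkFun (fun x => L.deriv f x (X x)) (L.contMDiff_deriv f.contMDiff X)) s := by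
  ext x
  exact D.leibniz f s x _

theorem curvatureOp_add (X Y : Cₛ^∞⟮I; F, A⟯) (s t : Cₛ^∞⟮I; F', V⟯) :
    D.curvatureOp X Y (s + t) = D.curvatureOp X Y s + D.curvatureOp X Y t := by
  simp only [curvatureOp, cov_add]
  abel

theorem curvatureOp_add_right (X Y Z : Cₛ^∞⟮I; F, A⟯) (s : Cₛ^∞⟮I; F', V⟯) :
    D.curvatureOp X (Y + Z) s = D.curvatureOp X Y s + D.curvatureOp X Z s := by
  simp only [curvatureOp, cov_add, cov_add_left, L.bracket_add_right]
  abel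

theorem curvatureOp_add_left (X Y Z : Cₛ^∞⟮I; F, A⟯) (s : Cₛ^∞⟮I; F', V⟯) :
    D.curvatureOp (X + Y) Z s = D.curvatureOp X Z s + D.curvatureOp Y Z s := by
  simp only [curvatureOp, cov_add, cov_add_left, L.bracket_add_left]
  abel

theorem curvatureOp_funSMul (X Y : Cₛ^∞⟮I; F, A⟯) (f : C^∞⟮I, M; ℝ⟯) (s : Cₛ^∞⟮I; F', V⟯) :
    D.curvatureOp X Y (funSMul f s) = funSMul f (D.curvatureOp X Y s) := by
  ext x
  simp only [curvatureOp, cov_funSMul, cov_add, ContMDiffSection.coe_sub, Pi.sub_apply,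
    ContMDiffSection.coe_add, Pi.add_apply, funSMul_apply, mkFun_apply, L.deriv_bracket,
    cov_apply]
  rw [show ⇑(mkFun (fun x => L.deriv (⇑f) x (X x)) (L.contMDiff_deriv f.contMDiff X)) =
      fun x => L.deriv (⇑f) x (X x) from rfl,
    show ⇑(mkFun (fun x => L.deriv (⇑f) x (Y x)) (L.contMDiff_deriv f.contMDiff Y)) =
      fun x => L.deriv (⇑f) x (Y x) from rfl]
  module

theorem curvatureOp_funSMul_right (X Y : Cₛ^∞⟮I; F, A⟯) (f : C^∞⟮I, M; ℝ⟯)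
    (s : Cₛ^∞⟮I; F', V⟯) :
    D.curvatureOp X (funSMul f Y) s = funSMul f (D.curvatureOp X Y s) := by
  ext x
  simp only [curvatureOp, cov_funSMul, cov_funSMul_left, cov_add_left, L.bracket_funSMul_right,
    ContMDiffSection.coe_sub, Pi.sub_apply,
    ContMDiffSection.coe_add, Pi.add_apply, funSMul_apply, mkFun_apply, cov_apply]
  module

theorem curvatureOp_funSMul_left (X Y : Cₛ^∞⟮I; F, A⟯) (f : C^∞⟮I, M; ℝ⟯)
    (s : Cₛ^∞⟮I; F', V⟯) :
    D.curvatureOp (funSMul f X) Y s = funSMul f (D.curvatureOp X Y s) := by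
  rw [curvatureOp_swap, curvatureOp_funSMul_right, D.curvatureOp_swap X Y]
  ext x
  simp

variable [T2Space M] [FiniteDimensional ℝ F] [ContMDiffVectorBundle ∞ F A I]
  [FiniteDimensional ℝ F'] [ContMDiffVectorBundle ∞ F' V I]

/-- The curvature tensor in `Λ²A* ⊗ End(V)`. -/
def curvature (x : M) : A x →ₗ[ℝ] A x →ₗ[ℝ] V x →ₗ[ℝ] V x :=
  tensorLift (I := I) (F := F)
    (fun X => tensorLift (I := I) (F := F)
      (fun Y => tensorLift (I := I) (F := F') (fun s => D.curvatureOp X Y s x)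
        (fun s t => by rw [curvatureOp_add]; rfl)
        (fun f s => by rw [curvatureOp_funSMul]; rfl))
      (fun Y Z => by
        ext v
        obtain ⟨s, rfl⟩ := exists_section I F' v
        rw [LinearMap.add_apply]
        simp only [tensorLift_apply, curvatureOp_add_right]
        rfl)
      (fun f Y => by
        ext v
        obtain ⟨s, rfl⟩ := exists_section I F' v
        rw [LinearMap.smul_apply]
        simp only [tensorLift_apply, curvatureOp_funSMul_right]
        rfl))
    (fun X Y => by
      ext u v
      obtain ⟨Z, rfl⟩ := exists_section I F u
      obtain ⟨s, rfl⟩ := exists_section I F' v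
      rw [LinearMap.add_apply]
      simp only [tensorLift_apply, curvatureOp_add_left, LinearMap.add_apply]
      rfl)
    (fun f X => by
      ext u v
      obtain ⟨Z, rfl⟩ := exists_section I F u
      obtain ⟨s, rfl⟩ := exists_section I F' v
      rw [LinearMap.smul_apply]
      simp only [tensorLift_apply, curvatureOp_funSMul_left, LinearMap.smul_apply]
      rfl)

theorem curvature_apply (X Y : Cₛ^∞⟮I; F, A⟯) (s : Cₛ^∞⟮I; F', V⟯) (x : M) :
    D.curvature x (X x) (Y x) (s x) = D.curvatureOp X Y s x := by
  simp only [curvature, tensorLift_apply]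

/-- The second covariant derivative `∇²_{X,Y} s = ∇_X ∇_Y s - ∇_{∇_X Y} s` with respect to a
connection `D₀` on `A`. -/
def secondCov (D₀ : Connection L F A) (s : Cₛ^∞⟮I; F', V⟯) (x : M) : A x →ₗ[ℝ] A x →ₗ[ℝ] V x :=
  LinearMap.flip (tensorLift (I := I) (F := F)
    (fun Y => D.toFun (D.cov Y s) x - D.toFun s x ∘ₗ D₀.toFun Y x)
    (fun Y Z => by
      ext v
      simp only [cov_add_left, D.add, D₀.add, LinearMap.sub_apply, LinearMap.comp_apply,
        LinearMap.add_apply, map_add]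
      abel)
    (fun f Y => by
      ext v
      simp only [cov_funSMul_left, D.leibniz, D₀.leibniz, LinearMap.sub_apply,
        LinearMap.comp_apply, LinearMap.smul_apply, map_add, map_smul, cov_apply]
      module))

theorem secondCov_apply (D₀ : Connection L F A) (X Y : Cₛ^∞⟮I; F, A⟯) (s : Cₛ^∞⟮I; F', V⟯)
    (x : M) : D.secondCov D₀ s x (X x) (Y x) =
      D.cov X (D.cov Y s) x - D.cov (D₀.cov X Y) s x := by
  simp only [secondCov, LinearMap.flip_apply, tensorLift_apply]
  rfl

end Connection

end Connections

section LeviCivita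

variable {E : Type*} [NormedAddCommGroup E] [NormedSpace ℝ E] [FiniteDimensional ℝ E]
  {H : Type*} [TopologicalSpace H] {I : ModelWithCorners ℝ E H}
  {M : Type*} [TopologicalSpace M] [ChartedSpace H M] [IsManifold I ∞ M] [T2Space M]
  {F : Type*} [NormedAddCommGroup F] [NormedSpace ℝ F] [FiniteDimensional ℝ F]
  {A : M → Type*} [TopologicalSpace (TotalSpace F A)] [∀ x, NormedAddCommGroup (A x)]
  [∀ x, InnerProductSpace ℝ (A x)] [FiberBundle F A] [VectorBundle ℝ F A]
  [ContMDiffVectorBundle ∞ F A I] [IsContMDiffRiemannianBundle I ∞ F A]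

/-- A connection on `A` is the Levi-Civita connection of the metric if it is metric and
torsion free. -/
structure Connection.IsLeviCivita {L : LieStructure I F A} (D : Connection L F A) : Prop where
  metric : ∀ (Y Z : Cₛ^∞⟮I; F, A⟯) x v, L.deriv (fun y => ⟪Y y, Z y⟫_ℝ) x v =
    ⟪D.toFun Y x v, Z x⟫_ℝ + ⟪Y x, D.toFun Z x v⟫_ℝ
  torsion_free : ∀ X Y : Cₛ^∞⟮I; F, A⟯, D.cov X Y - D.cov Y X = L.bracket X Y

namespace LieStructure

variable (L : LieStructure I F A)

theorem deriv_metric_add_left (X Y Z : Cₛ^∞⟮I; F, A⟯) (x : M) :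
    L.deriv (metricFun (X + Y) Z) x = L.deriv (metricFun X Z) x + L.deriv (metricFun Y Z) x := by
  rw [← L.deriv_add]
  congr 1
  ext y
  simp [inner_add_left]

theorem metricFun_comm (X Y : Cₛ^∞⟮I; F, A⟯) : metricFun X Y = metricFun Y X := by
  ext y
  simp [real_inner_comm]

theorem deriv_metric_add_right (X Y Z : Cₛ^∞⟮I; F, A⟯) (x : M) :
    L.deriv (metricFun X (Y + Z)) x = L.deriv (metricFun X Y) x + L.deriv (metricFun X Z) x := by
  rw [metricFun_comm, deriv_metric_add_left, metricFun_comm X, metricFun_comm X]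

theorem deriv_metric_smul_left (f : C^∞⟮I, M; ℝ⟯) (X Z : Cₛ^∞⟮I; F, A⟯) (x : M) :
    L.deriv (metricFun (funSMul f X) Z) x =
      f x • L.deriv (metricFun X Z) x + ⟪X x, Z x⟫_ℝ • L.deriv f x := by
  rw [← metricFun_apply, ← L.deriv_mul]
  congr 1
  ext y
  simp [inner_smul_left]

theorem deriv_metric_smul_right (f : C^∞⟮I, M; ℝ⟯) (X Z : Cₛ^∞⟮I; F, A⟯) (x : M) :
    L.deriv (metricFun X (funSMul f Z)) x =
      f x • L.deriv (metricFun X Z) x + ⟪X x, Z x⟫_ℝ • L.deriv f x := by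
  rw [metricFun_comm, deriv_metric_smul_left, metricFun_comm X, real_inner_comm]

/-- The right hand side of the Koszul formula for `g(∇_X Y, Z)`. -/
def koszul (X Y Z : Cₛ^∞⟮I; F, A⟯) (x : M) : ℝ :=
  (1 / 2) * (L.deriv (metricFun Y Z) x (X x) + L.deriv (metricFun X Z) x (Y x)
    - L.deriv (metricFun X Y) x (Z x) + ⟪L.bracket X Y x, Z x⟫_ℝ
    - ⟪L.bracket X Z x, Y x⟫_ℝ - ⟪L.bracket Y Z x, X x⟫_ℝ)

theorem contMDiff_koszul (X Y Z : Cₛ^∞⟮I; F, A⟯) :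
    ContMDiff I 𝓘(ℝ, ℝ) ∞ (L.koszul X Y Z) := by
  have h1 := fun U V W : Cₛ^∞⟮I; F, A⟯ => L.contMDiff_deriv (metricFun U V).contMDiff W
  have h2 := fun U V : Cₛ^∞⟮I; F, A⟯ => (metricFun U V).contMDiff
  exact contMDiff_const.mul ((((((h1 Y Z X).add (h1 X Z Y)).sub (h1 X Y Z)).add
    (h2 (L.bracket X Y) Z)).sub (h2 (L.bracket X Z) Y)).sub (h2 (L.bracket Y Z) X))

theorem koszul_add_left (X X' Y Z : Cₛ^∞⟮I; F, A⟯) (x : M) :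
    L.koszul (X + X') Y Z x = L.koszul X Y Z x + L.koszul X' Y Z x := by
  simp only [koszul, deriv_metric_add_left, bracket_add_left,
    ContMDiffSection.coe_add, Pi.add_apply, map_add, LinearMap.add_apply, inner_add_left,
    inner_add_right]
  ring

theorem koszul_add_mid (X Y Y' Z : Cₛ^∞⟮I; F, A⟯) (x : M) :
    L.koszul X (Y + Y') Z x = L.koszul X Y Z x + L.koszul X Y' Z x := by
  simp only [koszul, deriv_metric_add_left, deriv_metric_add_right, bracket_add_left,
    bracket_add_right,
    ContMDiffSection.coe_add, Pi.add_apply, map_add, LinearMap.add_apply, inner_add_left,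
    inner_add_right]
  ring

theorem koszul_add_right (X Y Z Z' : Cₛ^∞⟮I; F, A⟯) (x : M) :
    L.koszul X Y (Z + Z') x = L.koszul X Y Z x + L.koszul X Y Z' x := by
  simp only [koszul, deriv_metric_add_right, bracket_add_right,
    ContMDiffSection.coe_add, Pi.add_apply, map_add, LinearMap.add_apply, inner_add_left,
    inner_add_right]
  ring

theorem koszul_smul_left (f : C^∞⟮I, M; ℝ⟯) (X Y Z : Cₛ^∞⟮I; F, A⟯) (x : M) :
    L.koszul (funSMul f X) Y Z x = f x * L.koszul X Y Z x := by
  simp only [koszul, deriv_metric_smul_left, bracket_funSMul_left, ContMDiffSection.coe_sub,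
    Pi.sub_apply, funSMul_apply, mkFun_apply, map_smul, LinearMap.add_apply, LinearMap.smul_apply,
    inner_sub_left, real_inner_smul_left, real_inner_smul_right, smul_eq_mul]
  ring

theorem koszul_smul_mid (f : C^∞⟮I, M; ℝ⟯) (X Y Z : Cₛ^∞⟮I; F, A⟯) (x : M) :
    L.koszul X (funSMul f Y) Z x =
      f x * L.koszul X Y Z x + L.deriv f x (X x) * ⟪Y x, Z x⟫_ℝ := by
  simp only [koszul, deriv_metric_smul_left, deriv_metric_smul_right, bracket_funSMul_left,
    bracket_funSMul_right, ContMDiffSection.coe_sub, ContMDiffSection.coe_add, Pi.add_apply,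
    Pi.sub_apply, funSMul_apply, mkFun_apply, map_smul, LinearMap.add_apply, LinearMap.smul_apply,
    inner_sub_left, inner_add_left, real_inner_smul_left, real_inner_smul_right, smul_eq_mul]
  rw [real_inner_comm (X x) (Y x)]
  ring

theorem koszul_smul_right (f : C^∞⟮I, M; ℝ⟯) (X Y Z : Cₛ^∞⟮I; F, A⟯) (x : M) :
    L.koszul X Y (funSMul f Z) x = f x * L.koszul X Y Z x := by
  simp only [koszul, deriv_metric_smul_right, bracket_funSMul_right, ContMDiffSection.coe_add,
    Pi.add_apply, funSMul_apply, mkFun_apply, map_smul, LinearMap.add_apply, LinearMap.smul_apply,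
    inner_add_left, real_inner_smul_left, real_inner_smul_right, smul_eq_mul]
  rw [real_inner_comm (Y x) (Z x), real_inner_comm (X x) (Z x)]
  ring

/-- The functional `(u, w) ↦ g(∇_u Y, w)` given by the Koszul formula. -/
def koszulForm (Y : Cₛ^∞⟮I; F, A⟯) (x : M) : A x →ₗ[ℝ] A x →ₗ[ℝ] ℝ :=
  tensorLift (I := I) (F := F)
    (fun X => tensorLift (I := I) (F := F) (fun Z => L.koszul X Y Z x)
      (fun Z Z' => L.koszul_add_right X Y Z Z' x) (fun f Z => L.koszul_smul_right f X Y Z x))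
    (fun X X' => by
      ext w
      obtain ⟨Z, rfl⟩ := exists_section I F w
      simp only [tensorLift_apply, LinearMap.add_apply, koszul_add_left])
    (fun f X => by
      ext w
      obtain ⟨Z, rfl⟩ := exists_section I F w
      simp only [tensorLift_apply, LinearMap.smul_apply, koszul_smul_left, smul_eq_mul])

theorem koszulForm_apply (X Y Z : Cₛ^∞⟮I; F, A⟯) (x : M) :
    L.koszulForm Y x (X x) (Z x) = L.koszul X Y Z x := by
  simp only [koszulForm, tensorLift_apply]

theorem exists_riesz {T : Type*} [NormedAddCommGroup T] [InnerProductSpace ℝ T]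
    [FiniteDimensional ℝ T] (φ : T →ₗ[ℝ] ℝ) : ∃ v : T, ∀ w, ⟪v, w⟫_ℝ = φ w :=
  ⟨(InnerProductSpace.toDual ℝ T).symm (LinearMap.toContinuousLinearMap φ), fun w => by simp⟩

/-- Existence of the Levi-Civita connection, by the Koszul formula. -/
theorem exists_leviCivita : ∃ D : Connection L F A, D.IsLeviCivita := by
  have := fun x => VectorBundle.finiteDimensional ℝ F A x
  choose R hR using fun (Y : Cₛ^∞⟮I; F, A⟯) (x : M) (u : A x) =>
    exists_riesz (L.koszulForm Y x u)
  have hR' : ∀ (X Y Z : Cₛ^∞⟮I; F, A⟯) x, ⟪R Y x (X x), Z x⟫_ℝ = L.koszul X Y Z x :=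
    fun X Y Z x => by rw [hR, koszulForm_apply]
  let D : Connection L F A :=
    { toFun := fun Y x =>
        { toFun := R Y x
          map_add' := fun u v => ext_inner_right ℝ fun w => by
            simp only [hR, map_add, LinearMap.add_apply, inner_add_left]
          map_smul' := fun c u => ext_inner_right ℝ fun w => by
            simp only [hR, map_smul, LinearMap.smul_apply, real_inner_smul_left, smul_eq_mul,
              RingHom.id_apply] }
      smooth := fun Y X x => contMDiffAt_of_inner (fun x => R Y x (X x)) x fun Z => by
        simp only [hR']
        exact L.contMDiff_koszul X Y Z x
      add := fun Y Y' x u => ext_inner_right ℝ fun w => by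
        obtain ⟨X, rfl⟩ := exists_section I F u
        obtain ⟨Z, rfl⟩ := exists_section I F w
        simp only [LinearMap.coe_mk, AddHom.coe_mk, inner_add_left, hR', koszul_add_mid]
      leibniz := fun f Y x u => ext_inner_right ℝ fun w => by
        obtain ⟨X, rfl⟩ := exists_section I F u
        obtain ⟨Z, rfl⟩ := exists_section I F w
        simp only [LinearMap.coe_mk, AddHom.coe_mk, inner_add_left, hR', koszul_smul_mid,
          real_inner_smul_left] }
  have hD : ∀ (X Y Z : Cₛ^∞⟮I; F, A⟯) x, ⟪D.toFun Y x (X x), Z x⟫_ℝ = L.koszul X Y Z x := hR'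
  refine ⟨D, ⟨fun Y Z x v => ?_, fun X Y => ?_⟩⟩
  · obtain ⟨X, rfl⟩ := exists_section I F v
    rw [real_inner_comm (D.toFun Z x (X x)), hD, hD]
    change L.deriv (metricFun Y Z) x (X x) = _
    simp only [koszul, L.bracket_swap Z Y, metricFun_comm Z Y, ContMDiffSection.coe_neg,
      Pi.neg_apply, inner_neg_left]
    ring
  · ext x
    refine ext_inner_right ℝ fun w => ?_
    obtain ⟨Z, rfl⟩ := exists_section I F w
    simp only [ContMDiffSection.coe_sub, Pi.sub_apply, Connection.cov_apply, inner_sub_left, hD]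
    simp only [koszul, L.bracket_swap Y X, metricFun_comm Y X, ContMDiffSection.coe_neg,
      Pi.neg_apply, inner_neg_left]
    ring

/-- The Levi-Civita connection of the metric on `A`. -/
def leviCivita : Connection L F A := L.exists_leviCivita.choose

theorem isLeviCivita : L.leviCivita.IsLeviCivita := L.exists_leviCivita.choose_spec

end LieStructure

end LeviCivita

section CliffordModules

variable {E : Type*} [NormedAddCommGroup E] [NormedSpace ℝ E] [FiniteDimensional ℝ E]
  {H : Type*} [TopologicalSpace H] {I : ModelWithCorners ℝ E H}
  {M : Type*} [TopologicalSpace M] [ChartedSpace H M] [IsManifold I ∞ M] [T2Space M]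
  {F : Type*} [NormedAddCommGroup F] [NormedSpace ℝ F] [FiniteDimensional ℝ F]
  {A : M → Type*} [TopologicalSpace (TotalSpace F A)] [∀ x, NormedAddCommGroup (A x)]
  [∀ x, InnerProductSpace ℝ (A x)] [FiberBundle F A] [VectorBundle ℝ F A]
  [ContMDiffVectorBundle ∞ F A I] [IsContMDiffRiemannianBundle I ∞ F A]
  {F' : Type*} [NormedAddCommGroup F'] [NormedSpace ℂ F'] [FiniteDimensional ℂ F']
  {W : M → Type*} [TopologicalSpace (TotalSpace F' W)] [∀ x, NormedAddCommGroup (W x)]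
  [∀ x, InnerProductSpace ℂ (W x)] [FiberBundle F' W] [VectorBundle ℂ F' W]
  [VectorBundle ℝ F' W] [ContMDiffVectorBundle ∞ F' W I]

/-- The product of a complex number and a smooth section of a complex vector bundle. -/
def complexSMul (z : ℂ) (s : Cₛ^∞⟮I; F', W⟯) : Cₛ^∞⟮I; F', W⟯ :=
  ⟨fun x => z • s x, fun x₀ => by
    have h := (Bundle.contMDiffAt_section _).1 (s.contMDiff x₀)
    refine (Bundle.contMDiffAt_section _).2 ?_
    have hz : ContDiff ℝ ∞ (fun w : F' => z • w) := contDiff_const_smul z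
    refine (hz.contMDiff.contMDiffAt.comp x₀ h).congr_of_eventuallyEq ?_
    have hx₀ : (trivializationAt F' W x₀).baseSet ∈ 𝓝 x₀ :=
      (trivializationAt F' W x₀).open_baseSet.mem_nhds
        (FiberBundle.mem_baseSet_trivializationAt F' W x₀)
    filter_upwards [hx₀] with y hy
    exact ((trivializationAt F' W x₀).linear ℂ hy).map_smul z (s y)⟩

@[simp] theorem complexSMul_apply (z : ℂ) (s : Cₛ^∞⟮I; F', W⟯) (x : M) :
    complexSMul z s x = z • s x := rfl

/-- A `Cl(A)`-module `W`: a complex vector bundle with a hermitian metric, a Clifford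
multiplication `c`, an `A*`-valued connection that is metric and admissible (compatible with the
Levi-Civita connection of `A`), and a `ℤ/2`-grading `W = W⁺ ⊕ W⁻` which is compatible with the
Clifford action. -/
structure CliffordModule (L : LieStructure I F A) (F' : Type*) [NormedAddCommGroup F']
    [NormedSpace ℂ F'] [FiniteDimensional ℂ F'] (W : M → Type*)
    [TopologicalSpace (TotalSpace F' W)] [∀ x, NormedAddCommGroup (W x)]
    [∀ x, InnerProductSpace ℂ (W x)] [FiberBundle F' W] [VectorBundle ℂ F' W]
    [VectorBundle ℝ F' W] [ContMDiffVectorBundle ∞ F' W I] where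
  hermitian_smooth : ∀ s t : Cₛ^∞⟮I; F', W⟯, ContMDiff I 𝓘(ℝ, ℂ) ∞ (fun x => ⟪s x, t x⟫_ℂ)
  /-- The Clifford multiplication `v ⊗ w ↦ v · w`. -/
  c : ∀ x, A x →ₗ[ℝ] W x →ₗ[ℂ] W x
  c_smooth : ∀ (X : Cₛ^∞⟮I; F, A⟯) (s : Cₛ^∞⟮I; F', W⟯),
    ContMDiff I (I.prod 𝓘(ℝ, F')) ∞ (fun x => TotalSpace.mk' F' x (c x (X x) (s x)))
  clifford : ∀ x (u v : A x) (w : W x),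
    c x u (c x v w) + c x v (c x u w) + (2 * ⟪u, v⟫_ℝ : ℝ) • w = 0
  skew : ∀ x (v : A x) (w w' : W x), ⟪c x v w, w'⟫_ℂ = -⟪w, c x v w'⟫_ℂ
  /-- The connection `∇^W`. -/
  nabla : Connection L F' W
  nabla_smul : ∀ (z : ℂ) (s : Cₛ^∞⟮I; F', W⟯) x v,
    nabla.toFun (complexSMul z s) x v = z • nabla.toFun s x v
  nabla_metric : ∀ (s t : Cₛ^∞⟮I; F', W⟯) x v, L.deriv (fun y => ⟪s y, t y⟫_ℂ) x v =
    ⟪nabla.toFun s x v, t x⟫_ℂ + ⟪s x, nabla.toFun t x v⟫_ℂ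
  admissible : ∀ (X Y : Cₛ^∞⟮I; F, A⟯) (s : Cₛ^∞⟮I; F', W⟯) x,
    nabla.toFun ⟨fun y => c y (Y y) (s y), c_smooth Y s⟩ x (X x) =
      c x (L.leviCivita.cov X Y x) (s x) + c x (Y x) (nabla.cov X s x)
  /-- The grading involution, equal to `± 1` on `W^±`. -/
  grading : ∀ x, W x →ₗ[ℂ] W x
  grading_smooth : ∀ s : Cₛ^∞⟮I; F', W⟯,
    ContMDiff I (I.prod 𝓘(ℝ, F')) ∞ (fun x => TotalSpace.mk' F' x (grading x (s x)))
  grading_sq : ∀ x w, grading x (grading x w) = w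
  grading_c : ∀ x (v : A x) (w : W x), grading x (c x v w) = -c x v (grading x w)

namespace LieStructure

/-- The scalar curvature `κ = ∑ g(R(e_i, e_k) e_k, e_i)` of the metric. -/
def scalarCurvature (L : LieStructure I F A) (x : M) : ℝ :=
  ∑ i, ∑ k, ⟪L.leviCivita.curvature x (fiberBasis F A x i) (fiberBasis F A x k)
    (fiberBasis F A x k), fiberBasis F A x i⟫_ℝ

end LieStructure

namespace CliffordModule

variable {L : LieStructure I F A} (C : CliffordModule L F' W)

/-- The geometric Dirac operator `D = c ∘ (id ⊗ ♯) ∘ ∇^W`, that is `D s = ∑ e_i · ∇_{e_i} s` for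
an orthonormal frame. -/
def dirac (s : Cₛ^∞⟮I; F', W⟯) : Cₛ^∞⟮I; F', W⟯ :=
  ⟨fun x => metricTrace F (LinearMap.mk₂ ℝ (fun u v : A x => C.c x u (C.nabla.toFun s x v))
      (by simp) (by simp) (by simp) (by simp)),
    contMDiff_metricTrace _ fun X Y => C.c_smooth X (C.nabla.cov Y s)⟩

/-- The connection Laplacian `Δ^W = -∑ g^{ij} (∇_i ∇_j - ∑ Γ_{ij}^k ∇_k)`, that is minus the
trace of the second covariant derivative. -/
def laplacian (s : Cₛ^∞⟮I; F', W⟯) (x : M) : W x :=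
  -metricTrace F (C.nabla.secondCov L.leviCivita s x)

/-- The action `R^W(u, v) = ¼ ∑ g(R(u, v) e_k, e_l) e_k · e_l` of the Riemannian curvature. -/
def riemannAction (x : M) : A x →ₗ[ℝ] A x →ₗ[ℝ] W x →ₗ[ℝ] W x :=
  LinearMap.mk₂ ℝ (fun u v => (1 / 4 : ℝ) • ∑ k, ∑ l,
      ⟪L.leviCivita.curvature x u v (fiberBasis F A x k), fiberBasis F A x l⟫_ℝ •
        (C.c x (fiberBasis F A x k) ∘ₗ C.c x (fiberBasis F A x l)).restrictScalars ℝ)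
    (fun u u' v => by
      simp only [map_add, LinearMap.add_apply, inner_add_left, add_smul, Finset.sum_add_distrib,
        smul_add])
    (fun a u v => by
      simp only [map_smul, LinearMap.smul_apply, real_inner_smul_left, mul_smul, Finset.smul_sum]
      simp only [smul_comm a])
    (fun u v v' => by
      simp only [map_add, LinearMap.add_apply, inner_add_left, add_smul, Finset.sum_add_distrib,
        smul_add])
    (fun a u v => by
      simp only [map_smul, LinearMap.smul_apply, real_inner_smul_left, mul_smul, Finset.smul_sum]
      simp only [smul_comm a])

/-- The twisting curvature `F^{W/S} = (∇^W)² - R^W`. -/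
def twistingCurvature (x : M) : A x →ₗ[ℝ] A x →ₗ[ℝ] W x →ₗ[ℝ] W x :=
  C.nabla.curvature x - C.riemannAction x

/-- The Clifford action `c(T) = ∑_{i < j} T(e_i, e_j) e_i · e_j` of an endomorphism valued
two-form `T`. -/
def quantize {x : M} (T : A x →ₗ[ℝ] A x →ₗ[ℝ] W x →ₗ[ℝ] W x) (w : W x) : W x :=
  ∑ i, ∑ j ∈ Finset.univ.filter (i < ·), T (fiberBasis F A x i) (fiberBasis F A x j)
    (C.c x (fiberBasis F A x i) (C.c x (fiberBasis F A x j) w))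

/-- The family `T` is a smooth section of `Λ²(End_{Cl(A)} W)`: a smooth alternating two-form with
values in the complex linear endomorphisms of `W` that commute with Clifford multiplication. -/
structure IsEndCliffordTwoForm (T : ∀ x, A x →ₗ[ℝ] A x →ₗ[ℝ] W x →ₗ[ℝ] W x) : Prop where
  alternating : ∀ x u, T x u u = 0
  complex_linear : ∀ x u v (z : ℂ) w, T x u v (z • w) = z • T x u v w
  commute : ∀ x u v a w, T x u v (C.c x a w) = C.c x a (T x u v w)
  smooth : ∀ (X Y : Cₛ^∞⟮I; F, A⟯) (s : Cₛ^∞⟮I; F', W⟯),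
    ContMDiff I (I.prod 𝓘(ℝ, F')) ∞ (fun x => TotalSpace.mk' F' x (T x (X x) (Y x) (s x)))

end CliffordModule

end CliffordModules

section LieManifolds

/-- The model of manifolds with corners of dimension `n`: the quadrant `[0, ∞)ⁿ` in `ℝⁿ`. -/
abbrev corners (n : ℕ) :
    ModelWithCorners ℝ (EuclideanSpace ℝ (Fin n)) (EuclideanQuadrant n) :=
  modelWithCornersEuclideanQuadrant n

/-- A Lie manifold `(M, A, 𝓥)`, for a compact manifold with corners `M` of dimension `n`: the
vector fields in `𝓥` are tangent to all boundary faces (a face through `x` is given by the vanishing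
of some coordinates in a chart at `x`), and over the interior the anchor is an isomorphism
`A ≅ TM`. -/
structure LieManifold (n : ℕ) (M : Type*) [TopologicalSpace M]
    [ChartedSpace (EuclideanQuadrant n) M] [IsManifold (corners n) ∞ M]
    (F : Type*) [NormedAddCommGroup F] [NormedSpace ℝ F]
    (A : M → Type*) [TopologicalSpace (TotalSpace F A)] [∀ x, NormedAddCommGroup (A x)]
    [∀ x, InnerProductSpace ℝ (A x)] [FiberBundle F A] [VectorBundle ℝ F A]
    extends LieStructure (corners n) F A where
  tangent : ∀ X ∈ vectorFields, ∀ (x : M) (i : Fin n), extChartAt (corners n) x x i = 0 →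
    mvfderiv (corners n) (extChartAt (corners n) x) x (X x) i = 0
  anchor_bijective : ∀ x, (corners n).IsInteriorPoint x → Function.Bijective (anchor x)

end LieManifolds

end LieMfd

end

namespace LieMfd

set_option linter.unusedSectionVars false

/-! ### Sums of Clifford generators contracted with tensors. -/

section CliffordAlgebra

variable {ι : Type*} [Fintype ι]

/-! Since Clifford multiplication and the inverse metric are both parallel, differentiating `D s`
produces only the second covariant derivative, so that `D² s = ∑ e_i · e_j · ∇²_{e_i,e_j} s`
(`toFun_dirac`, `dirac_dirac`). The Clifford relation splits this double sum
(`sum_clifford_quadratic`). The diagonal is minus the trace of `∇²`, which is the connection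
Laplacian. Off the diagonal only the antisymmetric part of `∇²` survives, and because the
Levi-Civita connection is torsion free this part is the curvature of `∇^W` (`secondCov_sub_swap`).

It remains to write this curvature as `F^{W/S} + R^W`. The summand `R^W` contributes a quarter of
the scalar curvature (`sum_riemannAction`). This rests on the first Bianchi identity, which reduces
a product of three Clifford generators contracted with `R` to the Ricci tensor
(`sum_clifford_cubic`). Ricci is symmetric, so the fourth generator can only produce its trace
(`sum_clifford_quartic`).

The commutator with `c(a)` is `c(R(u,v)a)` both for the curvature of `∇^W`, by admissibility
(`curvature_c`), and for `R^W`, by the Clifford relations and the skewness of `R(u,v)`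
(`riemannAction_c`). The difference `F^{W/S}` therefore commutes with Clifford multiplication.

The usual frame with `∇e_i = 0` at a point is replaced by a pair of smooth frames `e`, `d` that are
dual for the metric. The derivatives of the two frames cancel in every contraction
(`sum_toFun_dual_frames`), so no adapted frame is needed. -/

theorem sum_rotate {N : Type*} [AddCommMonoid N] (f : ι → ι → ι → N) :
    ∑ i, ∑ j, ∑ k, f j k i = ∑ i, ∑ j, ∑ k, f i j k := by
  rw [Finset.sum_comm]
  exact Finset.sum_congr rfl fun j _ => Finset.sum_comm

variable [DecidableEq ι] {𝔸 : Type*} [Ring 𝔸] [Algebra ℝ 𝔸] {c : ι → 𝔸}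

/-- For Clifford generators `c i`, contracting `c i * c j * c k` with a tensor satisfying the
first Bianchi identity leaves only the trace of the tensor. -/
theorem sum_clifford_cubic
    (hc : ∀ i j, c i * c j + c j * c i = (if i = j then (-2 : ℝ) else 0) • 1)
    {r : ι → ι → ι → ℝ} (hr : ∀ i j k, r i j k = -r j i k)
    (hb : ∀ i j k, r i j k + r j k i + r k i j = 0) :
    ∑ i, ∑ j, ∑ k, r i j k • (c i * c j * c k) = (-2 : ℝ) • ∑ i, ∑ j, r i j j • c i := by
  have hii : ∀ i k, r i i k = 0 := fun i k => by linarith [hr i i k]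
  have hsw : ∀ i j, c i * c j = (if i = j then (-2 : ℝ) else 0) • 1 - c j * c i :=
    fun i j => eq_sub_of_add_eq (hc i j)
  -- Moving `c i` to the front, or `c k` to the end, brings every cyclic rotation back to the order
  -- `c i * c j * c k`, at the cost of two contractions.
  have e1 : ∀ i j k, c j * c k * c i = (if k = i then (-2 : ℝ) else 0) • c j
      - (if j = i then (-2 : ℝ) else 0) • c k + c i * c j * c k := by
    intro i j k
    rw [mul_assoc, hsw k i, mul_sub, ← mul_assoc, hsw j i, sub_mul]
    simp only [mul_smul_comm, smul_mul_assoc, mul_one, one_mul]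
    abel
  have e2 : ∀ i j k, c k * c i * c j = (if k = i then (-2 : ℝ) else 0) • c j
      - (if k = j then (-2 : ℝ) else 0) • c i + c i * c j * c k := by
    intro i j k
    rw [hsw k i, sub_mul, mul_assoc, hsw k j, mul_sub, ← mul_assoc]
    simp only [mul_smul_comm, smul_mul_assoc, mul_one, one_mul]
    abel
  set S := ∑ i, ∑ j, ∑ k, r i j k • (c i * c j * c k)
  have s1 : S = ∑ i, ∑ j, ∑ k, r j k i • (c j * c k * c i) :=
    (sum_rotate fun i j k => r i j k • (c i * c j * c k)).symm
  have s2 : S = ∑ i, ∑ j, ∑ k, r k i j • (c k * c i * c j) :=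
    s1.trans (sum_rotate fun i j k => r j k i • (c j * c k * c i)).symm
  -- In the sum of the three rotated copies of `S`, the coefficient of `c i * c j * c k` is the
  -- cyclic sum of `r`, which vanishes. Only the contractions are left.
  have h3 : S + S + S = ∑ i, ∑ j, ∑ k,
      (r j k i • ((if k = i then (-2 : ℝ) else 0) • c j - (if j = i then (-2 : ℝ) else 0) • c k) +
      r k i j • ((if k = i then (-2 : ℝ) else 0) • c j - (if k = j then (-2 : ℝ) else 0) • c i)) := by
    refine (congrArg₂ (· + ·) (congrArg₂ (· + ·) (Eq.refl S) s1) s2).trans ?_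
    simp only [S, ← Finset.sum_add_distrib]
    refine Finset.sum_congr rfl fun i _ => Finset.sum_congr rfl fun j _ =>
      Finset.sum_congr rfl fun k _ => ?_
    rw [e1 i j k, e2 i j k]
    rw [show r i j k = -r j k i - r k i j by linarith [hb i j k]]
    module
  -- With `T = ∑ r i j j • c i`, the antisymmetry of `r` turns the four contractions, without their
  -- factor `-2`, into `T`, `-T`, `0` and `-T`. With their signs they add up to `-6 T`.
  have h4 : S + S + S = (-6 : ℝ) • ∑ i, ∑ j, r i j j • c i := by
    have t1 : ∑ i, ∑ j, r j i i • c j = ∑ i, ∑ j, r i j j • c i := Finset.sum_comm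
    have t2 : ∑ i, ∑ k, r i k i • c k = -∑ i, ∑ j, r i j j • c i := by
      rw [← t1]
      simp only [← Finset.sum_neg_distrib, ← neg_smul, ← hr]
    have t3 : ∑ i, ∑ j, r j i j • c i = -∑ i, ∑ j, r i j j • c i := by
      simp only [← Finset.sum_neg_distrib, ← neg_smul, ← hr]
    have t4 : ∑ i, ∑ j, ∑ k, r j k i • ((if j = i then (-2 : ℝ) else 0) • c k) =
        (-2 : ℝ) • ∑ i, ∑ k, r i k i • c k := by
      rw [Finset.sum_congr rfl fun i _ => Finset.sum_comm]
      simp [Finset.smul_sum, smul_comm (-2 : ℝ), ite_smul, smul_ite]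
    have t5 : ∑ i, ∑ j, ∑ k, r j k i • ((if k = i then (-2 : ℝ) else 0) • c j) =
        (-2 : ℝ) • ∑ i, ∑ j, r j i i • c j := by
      simp [Finset.smul_sum, smul_comm (-2 : ℝ), ite_smul, smul_ite]
    have t6 : ∑ i, ∑ j, ∑ k, r k i j • ((if k = i then (-2 : ℝ) else 0) • c j) = 0 := by
      simp [ite_smul, smul_ite, hii]
    have t7 : ∑ i, ∑ j, ∑ k, r k i j • ((if k = j then (-2 : ℝ) else 0) • c i) =
        (-2 : ℝ) • ∑ i, ∑ j, r j i j • c i := by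
      simp [Finset.smul_sum, smul_comm (-2 : ℝ), ite_smul, smul_ite]
    rw [h3]
    simp only [smul_sub, Finset.sum_add_distrib, Finset.sum_sub_distrib]
    rw [t4, t5, t6, t7, t1, t2, t3]
    module
  have h5 : S = (1 / 3 : ℝ) • (S + S + S) := by module
  rw [h5, h4, smul_smul]
  norm_num

/-- The contraction of a curvature tensor with four Clifford generators is a multiple of the
scalar curvature. -/
theorem sum_clifford_quartic
    (hc : ∀ i j, c i * c j + c j * c i = (if i = j then (-2 : ℝ) else 0) • 1)
    {R : ι → ι → ι → ι → ℝ} (h12 : ∀ i j k l, R i j k l = -R j i k l)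
    (h34 : ∀ i j k l, R i j k l = -R i j l k)
    (hb : ∀ i j k l, R i j k l + R j k i l + R k i j l = 0) :
    ∑ i, ∑ j, ∑ k, ∑ l, R i j k l • (c i * c j * (c k * c l)) =
      (2 * ∑ i, ∑ j, R i j j i) • (1 : 𝔸) := by
  -- The classical octahedron argument: pair symmetry is a linear combination of the four Bianchi
  -- identities, with the two antisymmetries identifying the terms.
  have hpair : ∀ i j k l, R i j k l = R k l i j := by
    intro i j k l
    linarith [hb i j k l, hb j k l i, hb k l i j, hb l i j k, h12 i j k l, h12 j k i l, h12 k i j l,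
      h12 k l i j, h12 j k l i, h12 k l j i, h12 l j k i, h12 l i k j, h12 i k l j, h12 l i j k,
      h12 i j l k, h12 j l i k,
      h34 i j k l, h34 j k i l, h34 k i j l, h34 k l i j, h34 j k l i, h34 k l j i, h34 l j k i,
      h34 l i k j, h34 i k l j, h34 l i j k, h34 i j l k, h34 j l i k]
  -- Symmetry of the Ricci tensor.
  have hric : ∀ i l, ∑ j, R i j j l = ∑ j, R l j j i := fun i l =>
    Finset.sum_congr rfl fun j _ => by
      rw [hpair i j j l, h12 j l i j, h34 l j i j, neg_neg]
  have h1 : ∑ i, ∑ j, ∑ k, ∑ l, R i j k l • (c i * c j * (c k * c l)) =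
      ∑ l, (∑ i, ∑ j, ∑ k, R i j k l • (c i * c j * c k)) * c l := by
    simp only [Finset.sum_mul, smul_mul_assoc, mul_assoc]
    exact (Finset.sum_comm.trans (Finset.sum_congr rfl fun i _ =>
      Finset.sum_comm.trans (Finset.sum_congr rfl fun j _ => Finset.sum_comm))).symm
  set ρ : ι → ι → ℝ := fun i l => ∑ j, R i j j l
  -- For a fixed last index `l`, the first three generators collapse to Ricci by the cubic identity.
  have h2 : ∀ l, ∑ i, ∑ j, ∑ k, R i j k l • (c i * c j * c k) = (-2 : ℝ) • ∑ i, ρ i l • c i := by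
    intro l
    rw [sum_clifford_cubic hc (r := fun i j k => R i j k l) (fun i j k => h12 i j k l)
      fun i j k => hb i j k l]
    simp only [ρ, Finset.sum_smul]
  set Q := ∑ l, ∑ i, ρ i l • (c i * c l)
  -- Symmetrizing `Q`, which is allowed since `ρ` is symmetric, brings in the anticommutator, and
  -- that sees only the diagonal.
  have h3 : Q + Q = ∑ l, ∑ i, ρ i l • (c i * c l + c l * c i) := by
    simp only [smul_add, Finset.sum_add_distrib]
    congr 1
    rw [Finset.sum_comm]
    exact Finset.sum_congr rfl fun l _ => Finset.sum_congr rfl fun i _ => by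
      rw [show ρ l i = ρ i l from hric l i]
  have h4 : Q + Q = (-2 * ∑ i, ρ i i) • (1 : 𝔸) := by
    rw [h3]
    simp only [hc, smul_smul, mul_ite, mul_zero, ← Finset.sum_smul, Finset.sum_ite_eq',
      Finset.mem_univ, if_true]
    rw [Finset.mul_sum]
    simp only [mul_comm]
  have h5 : ∑ l, ((-2 : ℝ) • ∑ i, ρ i l • c i) * c l = -(Q + Q) := by
    simp only [Q, smul_mul_assoc, Finset.sum_mul, ← Finset.smul_sum]
    module
  rw [h1, Finset.sum_congr rfl fun l _ => by rw [h2 l], h5, h4, ← neg_smul]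
  congr 1
  ring

/-- Pairs each `(i, j)` with `i < j` with its mirror image, to pass from full double sums to the
sums over `i < j` that define `quantize`. -/
theorem sum_eq_sum_diag_add_sum_lt {N : Type*} [AddCommMonoid N] [LinearOrder ι]
    (f : ι → ι → N) : ∑ i, ∑ j, f i j =
      ∑ i, f i i + ∑ i, ∑ j ∈ Finset.univ.filter (i < ·), (f i j + f j i) := by
  have h : ∑ i, ∑ j ∈ Finset.univ.filter (i < ·), f j i =
      ∑ i, ∑ j ∈ Finset.univ.filter (· < i), f i j := by
    simp only [Finset.sum_filter]
    exact Finset.sum_comm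
  simp only [Finset.sum_add_distrib]
  rw [h, ← Finset.sum_add_distrib, ← Finset.sum_add_distrib]
  refine Finset.sum_congr rfl fun i _ => ?_
  have h' : f i i = ∑ j, if i = j then f i j else 0 := by simp
  rw [h', Finset.sum_filter, Finset.sum_filter, ← Finset.sum_add_distrib, ← Finset.sum_add_distrib]
  refine Finset.sum_congr rfl fun j _ => ?_
  rcases lt_trichotomy i j with hij | rfl | hij
  · simp [hij, hij.ne, hij.not_gt]
  · simp
  · simp [hij, hij.ne', hij.not_gt]

/-- Contracting a bilinear form with two Clifford generators: the symmetric part contributes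
minus the trace. -/
theorem sum_clifford_quadratic {N : Type*} [AddCommGroup N] [Module ℝ N] [LinearOrder ι]
    {c : ι → Module.End ℝ N}
    (hc : ∀ i j, c i * c j + c j * c i = (if i = j then (-2 : ℝ) else 0) • 1)
    (T : ι → ι → N) :
    ∑ i, ∑ j, c i (c j (T i j)) =
      -∑ i, T i i + ∑ i, ∑ j ∈ Finset.univ.filter (i < ·), c i (c j (T i j - T j i)) := by
  have hsq : ∀ i w, c i (c i w) = -w := by
    intro i w
    have : c i (c i w) + c i (c i w) = (-2 : ℝ) • w := by
      simpa using LinearMap.congr_fun (hc i i) w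
    have h2 : c i (c i w) = (1 / 2 : ℝ) • (c i (c i w) + c i (c i w)) := by module
    rw [h2, this]
    module
  rw [sum_eq_sum_diag_add_sum_lt, ← Finset.sum_neg_distrib]
  congr 1
  · exact Finset.sum_congr rfl fun i _ => hsq i _
  -- For `i < j` the generators anticommute, so the mirror term `c j (c i (T j i))` is `-c i (c j (T
  -- j i))`.
  · refine Finset.sum_congr rfl fun i _ => Finset.sum_congr rfl fun j hj => ?_
    have hij : i < j := (Finset.mem_filter.1 hj).2
    have : c i (c j (T j i)) + c j (c i (T j i)) = 0 := by
      simpa [hij.ne] using LinearMap.congr_fun (hc i j) (T j i)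
    rw [map_sub, map_sub, eq_neg_of_add_eq_zero_left this, sub_neg_eq_add]

end CliffordAlgebra

/-! ### Jacobi identity, locality of connections, and symmetries of the curvature. -/

section LieStructures

variable {E : Type*} [NormedAddCommGroup E] [NormedSpace ℝ E] [FiniteDimensional ℝ E]
  {H : Type*} [TopologicalSpace H] {I : ModelWithCorners ℝ E H}
  {M : Type*} [TopologicalSpace M] [ChartedSpace H M] [IsManifold I ∞ M]
  {F : Type*} [NormedAddCommGroup F] [NormedSpace ℝ F]
  {A : M → Type*} [TopologicalSpace (TotalSpace F A)] [∀ x, NormedAddCommGroup (A x)]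
  [∀ x, InnerProductSpace ℝ (A x)] [FiberBundle F A] [VectorBundle ℝ F A]

namespace LieStructure

variable (L : LieStructure I F A)

theorem deriv_congr {Y : Type*} [NormedAddCommGroup Y] [NormedSpace ℝ Y] {f g : M → Y} {x : M}
    (h : f =ᶠ[𝓝 x] g) : L.deriv f x = L.deriv g x := by
  ext v
  simp only [deriv_apply, mvfderiv, h.mfderiv_eq (I := I) (I' := 𝓘(ℝ, Y))]
  rfl

theorem deriv_const {Y : Type*} [NormedAddCommGroup Y] [NormedSpace ℝ Y] (y : Y) (x : M) :
    L.deriv (fun _ => y) x = 0 := by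
  ext v
  simp only [deriv_apply, mvfderiv, mfderiv_const]
  rfl

/-- The Jacobi identity for the bracket on `Γ(A)`. -/
theorem bracket_bracket (X Y Z : Cₛ^∞⟮I; F, A⟯) : L.bracket X (L.bracket Y Z) =
    L.bracket (L.bracket X Y) Z + L.bracket Y (L.bracket X Z) := by
  have := FiniteDimensional.complete ℝ E
  have : IsManifold I (minSmoothness ℝ 3) M := by
    rw [minSmoothness_of_isRCLikeNormedField]
    exact IsManifold.of_le (n := ∞) (by norm_cast)
  have h : ∀ X : Cₛ^∞⟮I; F, A⟯, ∀ x, ContMDiffAt I I.tangent (minSmoothness ℝ 2)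
      (fun x => (⟨x, L.anchor x (X x)⟩ : TangentBundle I M)) x := fun X x => by
    rw [minSmoothness_of_isRCLikeNormedField]
    exact ((L.anchor_smooth X) x).of_le (by norm_cast)
  -- A section of `A` is determined by its image under the anchor, so the identity is inherited from
  -- vector fields.
  refine L.anchor_injective _ _ fun x => ?_
  simp only [ContMDiffSection.coe_add, Pi.add_apply, map_add, anchor_bracket]
  exact VectorField.leibniz_identity_mlieBracket_apply (h X x) (h Y x) (h Z x)

end LieStructure

variable {F' : Type*} [NormedAddCommGroup F'] [NormedSpace ℝ F']
  {V : M → Type*} [TopologicalSpace (TotalSpace F' V)] [∀ x, AddCommGroup (V x)]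
  [∀ x, Module ℝ (V x)] [∀ x, TopologicalSpace (V x)] [FiberBundle F' V] [VectorBundle ℝ F' V]

namespace Connection

variable {L : LieStructure I F A} (D : Connection L F' V)

theorem cov_sub (X : Cₛ^∞⟮I; F, A⟯) (s t : Cₛ^∞⟮I; F', V⟯) :
    D.cov X (s - t) = D.cov X s - D.cov X t :=
  map_sub (AddMonoidHom.mk' (D.cov X) (D.cov_add X)) s t

theorem cov_sub_left (X Y : Cₛ^∞⟮I; F, A⟯) (s : Cₛ^∞⟮I; F', V⟯) :
    D.cov (X - Y) s = D.cov X s - D.cov Y s := by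
  ext x
  simp

theorem toFun_sum {ι : Type*} (t : Finset ι) (s : ι → Cₛ^∞⟮I; F', V⟯) (x : M) (v : A x) :
    D.toFun (∑ i ∈ t, s i) x v = ∑ i ∈ t, D.toFun (s i) x v :=
  map_sum (AddMonoidHom.mk' (fun s => D.toFun s x v) fun s t => D.add s t x v) s t

/-- A connection is a local operator. -/
theorem toFun_congr [T2Space M] {s t : Cₛ^∞⟮I; F', V⟯} {x : M} (h : ∀ᶠ y in 𝓝 x, s y = t y) :
    D.toFun s x = D.toFun t x := by
  obtain ⟨χ, -, hχ⟩ := (SmoothBumpFunction.nhds_basis_support (I := I) h).mem_iff.1 h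
  let χ' : C^∞⟮I, M; ℝ⟯ := mkFun χ χ.contMDiff
  have h1 : funSMul χ' s = funSMul χ' t := by
    ext y
    by_cases hy : y ∈ Function.support χ
    · simp only [funSMul_apply, show s y = t y from hχ hy]
    · have : χ' y = 0 := by simpa using! hy
      simp only [funSMul_apply, this, zero_smul]
  ext v
  -- At `x` the cutoff equals 1. The terms with its derivative agree for `s` and `t` because `s x =
  -- t x`, so they cancel.
  have h2 := D.leibniz χ' s x v
  rw [h1, D.leibniz, h.self_of_nhds, show χ' x = 1 from χ.eq_one, one_smul, one_smul] at h2
  exact (add_right_cancel h2).symm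

variable [T2Space M] [FiniteDimensional ℝ F] [ContMDiffVectorBundle ∞ F A I]

/-- Antisymmetrizing the correction `∇_{∇_X Y}` gives `∇_{[X,Y]}` by vanishing torsion, and this is
the last term of the curvature. -/
theorem secondCov_sub_swap {D₀ : Connection L F A}
    (h : ∀ X Y : Cₛ^∞⟮I; F, A⟯, D₀.cov X Y - D₀.cov Y X = L.bracket X Y)
    [FiniteDimensional ℝ F'] [ContMDiffVectorBundle ∞ F' V I]
    (s : Cₛ^∞⟮I; F', V⟯) (x : M) (u v : A x) :
    D.secondCov D₀ s x u v - D.secondCov D₀ s x v u = D.curvature x u v (s x) := by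
  obtain ⟨X, rfl⟩ := exists_section I F u
  obtain ⟨Y, rfl⟩ := exists_section I F v
  rw [secondCov_apply, secondCov_apply, curvature_apply, curvatureOp, ← h, cov_sub_left]
  simp only [ContMDiffSection.coe_sub, Pi.sub_apply]
  abel

theorem curvature_swap [FiniteDimensional ℝ F'] [ContMDiffVectorBundle ∞ F' V I]
    (x : M) (u v : A x) (w : V x) : D.curvature x u v w = -D.curvature x v u w := by
  obtain ⟨X, rfl⟩ := exists_section I F u
  obtain ⟨Y, rfl⟩ := exists_section I F v
  obtain ⟨s, rfl⟩ := exists_section I F' w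
  rw [curvature_apply, curvature_apply, curvatureOp_swap]
  rfl

namespace IsLeviCivita

variable [IsContMDiffRiemannianBundle I ∞ F A] {D : Connection L F A}

/-- The first Bianchi identity. -/
theorem curvatureOp_cyclic (hD : D.IsLeviCivita) (X Y Z : Cₛ^∞⟮I; F, A⟯) :
    D.curvatureOp X Y Z + D.curvatureOp Y Z X + D.curvatureOp Z X Y = 0 := by
  -- Using vanishing torsion twice: `∇_X` is applied to `∇_Y Z - ∇_Z Y = [Y,Z]`, and then `∇_X [Y,Z]
  -- - ∇_{[Y,Z]} X = [X,[Y,Z]]`.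
  have h : ∀ X Y Z : Cₛ^∞⟮I; F, A⟯, D.cov X (D.cov Y Z) - D.cov X (D.cov Z Y) -
      D.cov (L.bracket Y Z) X = L.bracket X (L.bracket Y Z) := fun X Y Z => by
    rw [← D.cov_sub, hD.torsion_free, hD.torsion_free]
  have hJ : L.bracket X (L.bracket Y Z) + L.bracket Y (L.bracket Z X) +
      L.bracket Z (L.bracket X Y) = 0 := by
    rw [L.bracket_bracket X Y Z, L.bracket_swap Z (L.bracket X Y), L.bracket_swap Z X,
      L.bracket_swap Y (-L.bracket X Z), L.bracket_swap Y (L.bracket X Z)]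
    have : L.bracket (-L.bracket X Z) Y = -L.bracket (L.bracket X Z) Y :=
      map_neg (AddMonoidHom.mk' (fun U => L.bracket U Y) fun U V => L.bracket_add_left U V Y) _
    rw [this]
    abel
  -- The zero is replaced by the Jacobi sum, and each double bracket by its expression in covariant
  -- derivatives. The terms are then those of the three curvatures.
  rw [← hJ, ← h, ← h, ← h]
  simp only [curvatureOp]
  abel

theorem curvature_cyclic (hD : D.IsLeviCivita) (x : M) (u v w : A x) :
    D.curvature x u v w + D.curvature x v w u + D.curvature x w u v = 0 := by
  obtain ⟨X, rfl⟩ := exists_section I F u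
  obtain ⟨Y, rfl⟩ := exists_section I F v
  obtain ⟨Z, rfl⟩ := exists_section I F w
  simp only [curvature_apply]
  exact congrArg (fun s : Cₛ^∞⟮I; F, A⟯ => s x) (hD.curvatureOp_cyclic X Y Z)

theorem deriv_metricFun (hD : D.IsLeviCivita) (X Y Z : Cₛ^∞⟮I; F, A⟯) (x : M) :
    L.deriv (metricFun Y Z) x (X x) = metricFun (D.cov X Y) Z x + metricFun Y (D.cov X Z) x :=
  hD.metric Y Z x (X x)

/-- The two mixed terms together are symmetric under exchange of `X` and `Y`, so they drop out of
the commutator of derivatives. -/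
theorem deriv_deriv_metricFun (hD : D.IsLeviCivita) (X Y Z Z' : Cₛ^∞⟮I; F, A⟯) (x : M) :
    L.deriv (fun y => L.deriv (metricFun Z Z') y (Y y)) x (X x) =
      metricFun (D.cov X (D.cov Y Z)) Z' x + metricFun (D.cov Y Z) (D.cov X Z') x +
      (metricFun (D.cov X Z) (D.cov Y Z') x + metricFun Z (D.cov X (D.cov Y Z')) x) := by
  simp only [hD.deriv_metricFun Y]
  rw [L.deriv_add, LinearMap.add_apply, hD.deriv_metricFun, hD.deriv_metricFun]

/-- The derivative along `[X,Y]` is the commutator of the derivatives along `X` and `Y`. Applied to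
`g(Z,Z')`, for a metric connection, this says that `g(R(X,Y)Z,Z') + g(Z,R(X,Y)Z')` vanishes. -/
theorem inner_curvature (hD : D.IsLeviCivita) (x : M) (u v w w' : A x) :
    ⟪D.curvature x u v w, w'⟫_ℝ = -⟪D.curvature x u v w', w⟫_ℝ := by
  obtain ⟨X, rfl⟩ := exists_section I F u
  obtain ⟨Y, rfl⟩ := exists_section I F v
  obtain ⟨Z, rfl⟩ := exists_section I F w
  obtain ⟨Z', rfl⟩ := exists_section I F w'
  have h := L.deriv_bracket (metricFun Z Z') X Y x
  rw [hD.deriv_deriv_metricFun, hD.deriv_deriv_metricFun, hD.deriv_metricFun] at h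
  rw [curvature_apply, curvature_apply, real_inner_comm (Z x)]
  simp only [curvatureOp, ContMDiffSection.coe_sub, Pi.sub_apply, inner_sub_left, inner_sub_right,
    metricFun_apply] at h ⊢
  linarith

end IsLeviCivita

end Connection

end LieStructures

theorem eq_zero_of_eq_neg {N : Type*} [AddCommGroup N] [Module ℝ N] {a : N} (h : a = -a) :
    a = 0 := by
  rw [show a = (1 / 2 : ℝ) • (a - -a) by module, sub_eq_zero.2 h, smul_zero]

/-! ### Smooth dual frames and parallelism of the inverse metric. -/

section Frames

variable {E : Type*} [NormedAddCommGroup E] [NormedSpace ℝ E] [FiniteDimensional ℝ E]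
  {H : Type*} [TopologicalSpace H] {I : ModelWithCorners ℝ E H}
  {M : Type*} [TopologicalSpace M] [ChartedSpace H M] [IsManifold I ∞ M] [T2Space M]
  {F : Type*} [NormedAddCommGroup F] [NormedSpace ℝ F] [FiniteDimensional ℝ F]
  {A : M → Type*} [TopologicalSpace (TotalSpace F A)] [∀ x, NormedAddCommGroup (A x)]
  [∀ x, InnerProductSpace ℝ (A x)] [FiberBundle F A] [VectorBundle ℝ F A]
  [ContMDiffVectorBundle ∞ F A I] [IsContMDiffRiemannianBundle I ∞ F A]

theorem sum_apply {F' : Type*} [NormedAddCommGroup F'] [NormedSpace ℝ F']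
    {V : M → Type*} [TopologicalSpace (TotalSpace F' V)] [∀ x, AddCommGroup (V x)]
    [∀ x, Module ℝ (V x)] [∀ x, TopologicalSpace (V x)] [FiberBundle F' V] [VectorBundle ℝ F' V]
    {ι : Type*} (t : Finset ι) (s : ι → Cₛ^∞⟮I; F', V⟯) (x : M) :
    (∑ i ∈ t, s i) x = ∑ i ∈ t, s i x := by
  have := congrFun (map_sum (ContMDiffSection.coeAddHom I F' ∞ V) s t) x
  rw [Finset.sum_apply] at this
  exact this

variable (I F A) in
/-- Around every point there are global smooth sections `e i` and `d i` which near the point are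
frames dual to each other with respect to the metric. -/
theorem exists_dual_frames (x₀ : M) :
    ∃ e d : Fin (finrank ℝ F) → Cₛ^∞⟮I; F, A⟯, ∀ᶠ y in 𝓝 x₀,
      (∀ v : A y, v = ∑ i, ⟪d i y, v⟫_ℝ • e i y) ∧
        ∀ i j, ⟪d i y, e j y⟫_ℝ = if i = j then 1 else 0 := by
  obtain ⟨e, θ, hs, hθ⟩ := exists_frame I F A x₀
  have hd : ∀ i, ∃ d : Cₛ^∞⟮I; F, A⟯, ∀ y (v : A y), ⟪d y, v⟫_ℝ = θ i y v := by
    intro i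
    have := fun y => VectorBundle.finiteDimensional ℝ F A y
    -- The section `d i` is the Riesz representative of the coframe element `θ i`. It is smooth
    -- because its inner products with smooth sections are.
    choose D hD using fun y => LieStructure.exists_riesz (θ i y)
    refine ⟨⟨D, fun y => contMDiffAt_of_inner D y fun Z => ?_⟩, hD⟩
    simp only [hD]
    exact hs i Z y (Z.contMDiff y)
  choose d hd using hd
  refine ⟨e, d, ?_⟩
  simpa only [hd] using hθ

/-- The inverse metric is parallel. -/
theorem sum_toFun_dual_frames {L : LieStructure I F A} {D : Connection L F A}
    (hD : D.IsLeviCivita) {x : M} {e d : Fin (finrank ℝ F) → Cₛ^∞⟮I; F, A⟯}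
    (h : ∀ᶠ y in 𝓝 x, (∀ v : A y, v = ∑ i, ⟪d i y, v⟫_ℝ • e i y) ∧
        ∀ i j, ⟪d i y, e j y⟫_ℝ = if i = j then 1 else 0)
    {Y : Type*} [AddCommGroup Y] [Module ℝ Y] (B : A x →ₗ[ℝ] A x →ₗ[ℝ] Y) (v : A x) :
    ∑ i, (B (D.toFun (d i) x v) (e i x) + B (d i x) (D.toFun (e i) x v)) = 0 := by
  have hexp := h.self_of_nhds.1
  have hdual : ∀ w : A x, w = ∑ j, ⟪w, e j x⟫_ℝ • d j x := by
    intro w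
    refine ext_inner_right ℝ fun u => ?_
    conv_lhs => rw [hexp u]
    simp only [inner_sum, sum_inner, real_inner_smul_left, real_inner_smul_right]
    exact Finset.sum_congr rfl fun j _ => mul_comm _ _
  -- The function `g(d i, e j)` is constant near `x`, so the metric property makes the two covariant
  -- derivatives opposite in coordinates.
  have hskew : ∀ i j, ⟪D.toFun (d i) x v, e j x⟫_ℝ = -⟪d i x, D.toFun (e j) x v⟫_ℝ := by
    intro i j
    have h1 := hD.metric (d i) (e j) x v
    rw [L.deriv_congr (g := fun _ => if i = j then (1 : ℝ) else 0)
      (by filter_upwards [h] with y hy using hy.2 i j), L.deriv_const, LinearMap.zero_apply] at h1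
    linarith
  have h1 : ∀ i, B (D.toFun (d i) x v) (e i x) =
      ∑ j, -(⟪d i x, D.toFun (e j) x v⟫_ℝ • B (d j x) (e i x)) := by
    intro i
    conv_lhs => rw [hdual (D.toFun (d i) x v)]
    simp only [hskew, map_sum, map_smul, LinearMap.sum_apply, LinearMap.smul_apply, neg_smul,
      map_neg, LinearMap.neg_apply]
  have h2 : ∀ j, B (d j x) (D.toFun (e j) x v) =
      ∑ i, ⟪d i x, D.toFun (e j) x v⟫_ℝ • B (d j x) (e i x) := by
    intro j
    conv_lhs => rw [hexp (D.toFun (e j) x v)]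
    simp only [map_sum, map_smul]
  rw [Finset.sum_add_distrib, Finset.sum_congr rfl fun i _ => h1 i,
    Finset.sum_congr rfl fun i _ => h2 i, Finset.sum_comm, ← Finset.sum_add_distrib]
  exact Finset.sum_eq_zero fun j _ => by
    rw [← Finset.sum_add_distrib]
    exact Finset.sum_eq_zero fun i _ => neg_add_cancel _

end Frames

/-! ### Clifford modules and their twisting curvature. -/

section CliffordModules

variable {E : Type*} [NormedAddCommGroup E] [NormedSpace ℝ E] [FiniteDimensional ℝ E]
  {H : Type*} [TopologicalSpace H] {I : ModelWithCorners ℝ E H}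
  {M : Type*} [TopologicalSpace M] [ChartedSpace H M] [IsManifold I ∞ M] [T2Space M]
  {F : Type*} [NormedAddCommGroup F] [NormedSpace ℝ F] [FiniteDimensional ℝ F]
  {A : M → Type*} [TopologicalSpace (TotalSpace F A)] [∀ x, NormedAddCommGroup (A x)]
  [∀ x, InnerProductSpace ℝ (A x)] [FiberBundle F A] [VectorBundle ℝ F A]
  [ContMDiffVectorBundle ∞ F A I] [IsContMDiffRiemannianBundle I ∞ F A]
  {F' : Type*} [NormedAddCommGroup F'] [NormedSpace ℂ F'] [FiniteDimensional ℂ F']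
  {W : M → Type*} [TopologicalSpace (TotalSpace F' W)] [∀ x, NormedAddCommGroup (W x)]
  [∀ x, InnerProductSpace ℂ (W x)] [FiberBundle F' W] [VectorBundle ℂ F' W]
  [VectorBundle ℝ F' W] [ContMDiffVectorBundle ∞ F' W I]

namespace CliffordModule

variable {L : LieStructure I F A} (C : CliffordModule L F' W)

/-- The Clifford product of a section of `A` and a section of `W`. -/
noncomputable def mul (Y : Cₛ^∞⟮I; F, A⟯) (s : Cₛ^∞⟮I; F', W⟯) : Cₛ^∞⟮I; F', W⟯ :=
  ⟨fun y => C.c y (Y y) (s y), C.c_smooth Y s⟩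

@[simp] theorem mul_apply (Y : Cₛ^∞⟮I; F, A⟯) (s : Cₛ^∞⟮I; F', W⟯) (x : M) :
    C.mul Y s x = C.c x (Y x) (s x) := rfl

/-- Pointwise form of admissibility, for a vector that need not come with a chosen extension to a
section. -/
theorem toFun_mul (Y : Cₛ^∞⟮I; F, A⟯) (s : Cₛ^∞⟮I; F', W⟯) (x : M) (v : A x) :
    C.nabla.toFun (C.mul Y s) x v =
      C.c x (L.leviCivita.toFun Y x v) (s x) + C.c x (Y x) (C.nabla.toFun s x v) := by
  obtain ⟨X, rfl⟩ := exists_section I F v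
  exact C.admissible X Y s x

theorem cov_mul (X Y : Cₛ^∞⟮I; F, A⟯) (s : Cₛ^∞⟮I; F', W⟯) :
    C.nabla.cov X (C.mul Y s) = C.mul (L.leviCivita.cov X Y) s + C.mul Y (C.nabla.cov X s) := by
  ext x
  exact C.toFun_mul Y s x _

theorem cov_complexSMul (z : ℂ) (X : Cₛ^∞⟮I; F, A⟯) (s : Cₛ^∞⟮I; F', W⟯) :
    C.nabla.cov X (complexSMul z s) = complexSMul z (C.nabla.cov X s) := by
  ext x
  exact C.nabla_smul z s x _

theorem curvature_smul (x : M) (u v : A x) (z : ℂ) (w : W x) :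
    C.nabla.curvature x u v (z • w) = z • C.nabla.curvature x u v w := by
  obtain ⟨X, rfl⟩ := exists_section I F u
  obtain ⟨Y, rfl⟩ := exists_section I F v
  obtain ⟨s, rfl⟩ := exists_section I F' w
  rw [← complexSMul_apply, Connection.curvature_apply, Connection.curvature_apply]
  simp only [Connection.curvatureOp, cov_complexSMul, ContMDiffSection.coe_sub, Pi.sub_apply,
    complexSMul_apply, smul_sub]

/-- The curvature of an admissible connection is a derivation over the curvature of `A`. -/
theorem curvature_c (x : M) (u v a : A x) (w : W x) :
    C.nabla.curvature x u v (C.c x a w) =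
      C.c x (L.leviCivita.curvature x u v a) w + C.c x a (C.nabla.curvature x u v w) := by
  obtain ⟨X, rfl⟩ := exists_section I F u
  obtain ⟨Y, rfl⟩ := exists_section I F v
  obtain ⟨Z, rfl⟩ := exists_section I F a
  obtain ⟨s, rfl⟩ := exists_section I F' w
  rw [← mul_apply, Connection.curvature_apply, Connection.curvature_apply,
    Connection.curvature_apply]
  -- The mixed terms `∇_X Z · ∇_Y s + ∇_Y Z · ∇_X s` are symmetric in `X` and `Y` and cancel.
  simp only [Connection.curvatureOp, cov_mul, Connection.cov_add, ContMDiffSection.coe_sub,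
    ContMDiffSection.coe_add, Pi.sub_apply, Pi.add_apply, mul_apply, map_sub, LinearMap.sub_apply]
  abel

theorem c_c_swap (x : M) (u v : A x) (w : W x) :
    C.c x u (C.c x v w) = -C.c x v (C.c x u w) - (2 * ⟪u, v⟫_ℝ : ℝ) • w := by
  rw [sub_eq_add_neg, ← sub_eq_iff_eq_add', sub_neg_eq_add]
  exact eq_neg_of_add_eq_zero_left (C.clifford x u v w)

/-- An orthonormal frame at `x`, acting by Clifford multiplication. -/
noncomputable def frameAction (x : M) (i : Fin (finrank ℝ F)) : Module.End ℝ (W x) :=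
  (C.c x (fiberBasis F A x i)).restrictScalars ℝ

@[simp] theorem frameAction_apply (x : M) (i : Fin (finrank ℝ F)) (w : W x) :
    C.frameAction x i w = C.c x (fiberBasis F A x i) w := rfl

theorem frameAction_anticomm (x : M) (i j : Fin (finrank ℝ F)) :
    C.frameAction x i * C.frameAction x j + C.frameAction x j * C.frameAction x i =
      (if i = j then (-2 : ℝ) else 0) • 1 := by
  ext w
  have h := eq_neg_of_add_eq_zero_left
    (C.clifford x (fiberBasis F A x i) (fiberBasis F A x j) w)
  rw [orthonormal_iff_ite.1 (fiberBasis F A x).orthonormal i j] at h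
  simp only [LinearMap.add_apply, Module.End.mul_apply, frameAction_apply, h, LinearMap.smul_apply,
    Module.End.one_apply]
  split_ifs <;> simp

/-- Summing over `l` reassembles `R(u,v)e_k` from its coordinates. As a metric trace the result no
longer depends on the pointwise basis, which need not vary smoothly; smoothness in
`contMDiff_riemannAction` rests on this. -/
theorem riemannAction_apply (x : M) (u v : A x) (w : W x) :
    C.riemannAction x u v w = (1 / 4 : ℝ) • metricTrace F (LinearMap.mk₂ ℝ
      (fun a b : A x => C.c x a (C.c x (L.leviCivita.curvature x u v b) w))
      (by simp) (by simp) (by simp) (by simp)) := by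
  rw [riemannAction, LinearMap.mk₂_apply, metricTrace]
  simp only [LinearMap.smul_apply, LinearMap.sum_apply, LinearMap.mk₂_apply]
  congr 1
  refine Finset.sum_congr rfl fun k _ => ?_
  conv_rhs => rw [← (fiberBasis F A x).sum_repr' (L.leviCivita.curvature x u v (fiberBasis F A x k))]
  simp [map_sum, LinearMap.sum_apply, real_inner_comm]

/-- Moving `a` to the left through `e_k · R(u,v)e_k` leaves two corrections. After summing over `k`
each equals `2 c(R(u,v)a)`, the second by skewness of `R(u,v)`; the factor `1/4` normalizes their
total. This is the same derivation rule as in `curvature_c`. -/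
theorem riemannAction_c (x : M) (u v a : A x) (w : W x) :
    C.riemannAction x u v (C.c x a w) =
      C.c x (L.leviCivita.curvature x u v a) w + C.c x a (C.riemannAction x u v w) := by
  set b := fiberBasis F A x
  set R := L.leviCivita.curvature x u v
  have h : ∀ k, C.c x (b k) (C.c x (R (b k)) (C.c x a w)) =
      C.c x a (C.c x (b k) (C.c x (R (b k)) w)) + (2 * ⟪b k, a⟫_ℝ) • C.c x (R (b k)) w
        - (2 * ⟪R (b k), a⟫_ℝ) • C.c x (b k) w := by
    intro k
    rw [C.c_c_swap x (R (b k)) a w, map_sub, map_neg, C.c_c_swap x (b k) a]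
    simp only [LinearMap.map_smul_of_tower]
    abel
  have h1 : ∑ k, ⟪b k, a⟫_ℝ • C.c x (R (b k)) w = C.c x (R a) w := by
    conv_rhs => rw [← b.sum_repr' a]
    simp [map_sum, LinearMap.sum_apply]
  have h2 : ∑ k, ⟪R (b k), a⟫_ℝ • C.c x (b k) w = -C.c x (R a) w := by
    conv_rhs => rw [← b.sum_repr' (R a)]
    simp only [map_sum, map_smul, LinearMap.sum_apply, LinearMap.smul_apply,
      ← Finset.sum_neg_distrib, ← neg_smul]
    refine Finset.sum_congr rfl fun k _ => ?_
    rw [L.isLeviCivita.inner_curvature x u v (b k) a, real_inner_comm]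
  rw [riemannAction_apply, riemannAction_apply, metricTrace, metricTrace]
  simp only [LinearMap.mk₂_apply]
  rw [Finset.sum_congr rfl fun k _ => h k]
  simp only [Finset.sum_add_distrib, Finset.sum_sub_distrib, mul_smul, ← Finset.smul_sum]
  rw [h1, h2, LinearMap.map_smul_of_tower, map_sum]
  module

theorem contMDiff_riemannAction (X Y : Cₛ^∞⟮I; F, A⟯) (s : Cₛ^∞⟮I; F', W⟯) :
    ContMDiff I (I.prod 𝓘(ℝ, F')) ∞
      (fun x => TotalSpace.mk' F' x (C.riemannAction x (X x) (Y x) (s x))) := by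
  simp only [riemannAction_apply]
  refine ContMDiff.smul_section contMDiff_const (contMDiff_metricTrace _ fun U V => ?_)
  simp only [LinearMap.mk₂_apply, Connection.curvature_apply]
  exact (C.mul U (C.mul (L.leviCivita.curvatureOp X Y V) s)).contMDiff

/-- The twisting curvature is a two-form with values in `End_{Cl(A)} W`. -/
theorem isEndCliffordTwoForm_twistingCurvature :
    C.IsEndCliffordTwoForm C.twistingCurvature where
  alternating x u := by
    ext w
    have h1 : C.nabla.curvature x u u w = 0 := 
      eq_zero_of_eq_neg (C.nabla.curvature_swap x u u w)
    have h2 : ∀ a, L.leviCivita.curvature x u u a = 0 := fun a =>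
      eq_zero_of_eq_neg (L.leviCivita.curvature_swap x u u a)
    simp [twistingCurvature, h1, riemannAction_apply, metricTrace, h2]
  complex_linear x u v z w := by
    simp only [twistingCurvature, LinearMap.sub_apply, curvature_smul, riemannAction_apply,
      metricTrace, LinearMap.mk₂_apply, map_smul, smul_sub, ← Finset.smul_sum]
    rw [smul_comm]
  commute x u v a w := by
    simp only [twistingCurvature, LinearMap.sub_apply, curvature_c, riemannAction_c, map_sub]
    abel
  smooth X Y s := by
    have h := (C.nabla.curvatureOp X Y s).contMDiff.sub_section (C.contMDiff_riemannAction X Y s)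
    simp only [twistingCurvature, LinearMap.sub_apply, Connection.curvature_apply]
    exact h

/-! ### The square of the Dirac operator and the Lichnerowicz formula. -/

theorem dirac_apply (s : Cₛ^∞⟮I; F', W⟯) (x : M) : C.dirac s x =
    ∑ i, C.c x (fiberBasis F A x i) (C.nabla.toFun s x (fiberBasis F A x i)) := rfl

/-- The derivatives that fall on the frames add up to the derivative of the inverse metric, which is
zero. -/
theorem toFun_dirac (s : Cₛ^∞⟮I; F', W⟯) (x : M) (v : A x) :
    C.nabla.toFun (C.dirac s) x v = ∑ i, C.c x (fiberBasis F A x i)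
      (C.nabla.secondCov L.leviCivita s x v (fiberBasis F A x i)) := by
  obtain ⟨e, d, h⟩ := exists_dual_frames I F A x
  -- Near `x` the section `D s` is a finite sum of globally smooth products, and the connection sees
  -- only this germ.
  have h1 : ∀ᶠ y in 𝓝 x, C.dirac s y = (∑ i, C.mul (d i) (C.nabla.cov (e i) s)) y := by
    filter_upwards [h] with y hy
    rw [sum_apply]
    exact metricTrace_eq_of_dual _ (fun i => e i y) (fun i => d i y) hy.1
  have h2 := metricTrace_eq_of_dual (F := F) (LinearMap.mk₂ ℝ
      (fun a b : A x => C.c x a (C.nabla.secondCov L.leviCivita s x v b))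
      (by simp) (by simp) (by simp) (by simp)) (fun i => e i x) (fun i => d i x)
      h.self_of_nhds.1
  have h3 := sum_toFun_dual_frames L.isLeviCivita h (LinearMap.mk₂ ℝ
      (fun a b : A x => C.c x a (C.nabla.toFun s x b))
      (by simp) (by simp) (by simp) (by simp)) v
  simp only [metricTrace, LinearMap.mk₂_apply] at h2 h3
  rw [h2, C.nabla.toFun_congr h1, Connection.toFun_sum, ← sub_eq_zero, ← Finset.sum_sub_distrib,
    ← h3]
  -- Termwise, `∇_v(d_i · ∇_{e_i} s) - d_i · ∇²_{v,e_i} s` equals `(∇_v d_i) · ∇_{e_i} s + d_i ·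
  -- ∇_{∇_v e_i} s`, the summand of `h3`.
  refine Finset.sum_congr rfl fun i _ => ?_
  obtain ⟨X, rfl⟩ := exists_section I F v
  rw [Connection.secondCov_apply, toFun_mul, map_sub]
  simp only [Connection.cov_apply]
  abel

theorem dirac_dirac (s : Cₛ^∞⟮I; F', W⟯) (x : M) : C.dirac (C.dirac s) x =
    ∑ i, ∑ j, C.c x (fiberBasis F A x i) (C.c x (fiberBasis F A x j)
      (C.nabla.secondCov L.leviCivita s x (fiberBasis F A x i) (fiberBasis F A x j))) := by
  simp only [C.dirac_apply (C.dirac s), toFun_dirac, map_sum]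

/-- The Clifford contraction of `R^W` is a quarter of the scalar curvature. -/
theorem sum_riemannAction (x : M) (w : W x) :
    ∑ i, ∑ j ∈ Finset.univ.filter (i < ·), C.c x (fiberBasis F A x i)
      (C.c x (fiberBasis F A x j)
        (C.riemannAction x (fiberBasis F A x i) (fiberBasis F A x j) w)) =
      (L.scalarCurvature x / 4 : ℝ) • w := by
  set b := fiberBasis F A x
  set R : Fin (finrank ℝ F) → Fin (finrank ℝ F) → Fin (finrank ℝ F) → Fin (finrank ℝ F) → ℝ :=
    fun i j k l => ⟪L.leviCivita.curvature x (b i) (b j) (b k), b l⟫_ℝ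
  have hR : ∀ i j, C.riemannAction x (b i) (b j) w =
      (1 / 4 : ℝ) • ∑ k, ∑ l, R i j k l • C.frameAction x k (C.frameAction x l w) := by
    intro i j
    rw [riemannAction, LinearMap.mk₂_apply]
    simp only [LinearMap.smul_apply, LinearMap.sum_apply]
    rfl
  have h4 := LinearMap.congr_fun (sum_clifford_quartic (R := R) (C.frameAction_anticomm x)
    (fun i j k l => by
      simp only [R]
      rw [L.leviCivita.curvature_swap, inner_neg_left])
    (fun i j k l => L.isLeviCivita.inner_curvature x _ _ _ _)
    (fun i j k l => by
      simp only [R, ← inner_add_left]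
      rw [L.isLeviCivita.curvature_cyclic, inner_zero_left])) w
  -- `R^W` is antisymmetric, so its trace vanishes and the full double sum is twice the sum over `i
  -- < j`.
  have h2 := sum_clifford_quadratic (C.frameAction_anticomm x)
    fun i j => C.riemannAction x (b i) (b j) w
  have hsw : ∀ i j, C.riemannAction x (b j) (b i) w = -C.riemannAction x (b i) (b j) w := by
    intro i j
    have : ∀ k l, R j i k l = -R i j k l := fun k l => by
      simp only [R]
      rw [L.leviCivita.curvature_swap, inner_neg_left]
    simp only [hR, this, neg_smul, Finset.sum_neg_distrib, smul_neg]
  have hd : ∀ i, C.riemannAction x (b i) (b i) w = 0 := fun i => eq_zero_of_eq_neg (hsw i i)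
  -- The quartic identity gives `2 κ`, and the `1/4` in `R^W` makes the full sum `κ/2`; half of it
  -- is the claimed `κ/4`.
  have h1 : ∑ i, ∑ j, C.frameAction x i (C.frameAction x j (C.riemannAction x (b i) (b j) w)) =
      (1 / 4 : ℝ) • (2 * L.scalarCurvature x) • w := by
    rw [show (2 * L.scalarCurvature x) • w = ((2 * ∑ i, ∑ j, R i j j i) •
      (1 : Module.End ℝ (W x))) w from rfl, ← h4]
    simp only [hR, LinearMap.sum_apply, map_smul, map_sum, LinearMap.smul_apply,
      Module.End.mul_apply, Finset.smul_sum]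
  have hdiff : ∀ i j, C.frameAction x i (C.frameAction x j
      (C.riemannAction x (b i) (b j) w - C.riemannAction x (b j) (b i) w)) =
      (2 : ℝ) • C.frameAction x i (C.frameAction x j (C.riemannAction x (b i) (b j) w)) := by
    intro i j
    rw [hsw i j, sub_neg_eq_add, ← two_smul ℝ, map_smul, map_smul]
  rw [h1] at h2
  simp only [hd, Finset.sum_const_zero, neg_zero, zero_add, hdiff, ← Finset.smul_sum] at h2
  have h3 := congrArg (fun w => (1 / 2 : ℝ) • w) h2
  simp only [smul_smul] at h3
  norm_num at h3
  refine h3.symm.trans ?_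
  congr 1
  ring

/-- The Lichnerowicz formula. -/
theorem lichnerowicz (s : Cₛ^∞⟮I; F', W⟯) (x : M) :
    C.dirac (C.dirac s) x = C.laplacian s x + C.quantize (C.twistingCurvature x) (s x) +
      (L.scalarCurvature x / 4 : ℝ) • s x := by
  rw [dirac_dirac, laplacian, metricTrace, add_assoc, ← C.sum_riemannAction, quantize]
  refine (sum_clifford_quadratic (C.frameAction_anticomm x) fun i j =>
    C.nabla.secondCov L.leviCivita s x (fiberBasis F A x i) (fiberBasis F A x j)).trans ?_
  rw [← Finset.sum_add_distrib]
  congr 1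
  refine Finset.sum_congr rfl fun i _ => ?_
  rw [← Finset.sum_add_distrib]
  refine Finset.sum_congr rfl fun j _ => ?_
  -- `quantize` applies the two-form after the Clifford factors, whereas here it acts first;
  -- `commute` moves it past both. The curvature of `∇^W` is then `F^{W/S} + R^W` by definition.
  rw [Connection.secondCov_sub_swap _ L.isLeviCivita.torsion_free,
    C.isEndCliffordTwoForm_twistingCurvature.commute,
    C.isEndCliffordTwoForm_twistingCurvature.commute, ← map_add, ← map_add, twistingCurvature]
  simp

end CliffordModule

end CliffordModules

end LieMfd

theorem theorem2p3 (n : ℕ)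
    (M : Type*) [TopologicalSpace M] [ChartedSpace (EuclideanQuadrant n) M]
    [IsManifold (LieMfd.corners n) ∞ M] [T2Space M] [CompactSpace M]
    (F : Type*) [NormedAddCommGroup F] [NormedSpace ℝ F] [FiniteDimensional ℝ F]
    (A : M → Type*) [TopologicalSpace (TotalSpace F A)] [∀ x, NormedAddCommGroup (A x)]
    [∀ x, InnerProductSpace ℝ (A x)] [FiberBundle F A] [VectorBundle ℝ F A]
    [ContMDiffVectorBundle ∞ F A (LieMfd.corners n)]
    [IsContMDiffRiemannianBundle (LieMfd.corners n) ∞ F A]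
    (F' : Type*) [NormedAddCommGroup F'] [NormedSpace ℂ F'] [FiniteDimensional ℂ F']
    (W : M → Type*) [TopologicalSpace (TotalSpace F' W)] [∀ x, NormedAddCommGroup (W x)]
    [∀ x, InnerProductSpace ℂ (W x)] [FiberBundle F' W] [VectorBundle ℂ F' W]
    [VectorBundle ℝ F' W] [ContMDiffVectorBundle ∞ F' W (LieMfd.corners n)]
    (L : LieMfd.LieManifold n M F A) (C : LieMfd.CliffordModule L.toLieStructure F' W) :
    C.IsEndCliffordTwoForm C.twistingCurvature ∧
      ∀ (s : Cₛ^∞⟮LieMfd.corners n; F', W⟯) (x : M),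
        C.dirac (C.dirac s) x = C.laplacian s x + C.quantize (C.twistingCurvature x) (s x) +
          (L.scalarCurvature x / 4 : ℝ) • s x := by
  exact ⟨C.isEndCliffordTwoForm_twistingCurvature, C.lichnerowicz⟩
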